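/- **Parameters.** Fix integers $b\le M$, $p\ge 1$, and boundary points $1=t_0>t_1=\frac12>t_2>\dots>t_b=\frac13>\dots>t_M>t_{M+1}=0$. An item of size in $(t_j,t_{j-1}]$ is of class $j$; class $1$ is huge, classes $2,\dots,b$ are large, $b+1,\dots,M$ small, and $M+1$ tiny. Let $\gamma_j=\lfloor 1/t_{j-1}\rfloor$ and $A_{i,j}=i\,t_{j-1}$ for $2\le j\le M$, $i\ge1$; let $\gamma_{M+1}=p$ and fix $t_M\le A_{1,M+1}<\dots<A_{p,M+1}\le 1$. For $2\le j\le M+1$, $1\le i\le\gamma_j$ fix proportions $\alpha_{ij}\ge 0$ with $\sum_i\alpha_{ij}=1$, where $\alpha_{2j}>0$ for every large $j$, $\alpha_{i,M+1}>0$ for all $i$, and $\sum_i(A_{i,M+1}-t_M)\alpha_{i,M+1}>0$. **Containers.** Algorithm AH packs items (sizes in $(0,1]$, arriving one by one) into containers and containers into bins. A container holds items of one class and has a type. Huge items form type 1 containers. A container of a large class is a *temporary* or *regular* type 1 container (one item), a *declared* type 2 container (one item so far), or a *regular* type 2 container (two items). A type $i$ container of a small class is open while it has fewer than $i$ items; a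 type $i$ container of tiny items is open while their total size is at most $A_{i,M+1}-t_M$. The volume of a type 1 container of a huge or large class is the size of its item; the volume of any other type $i$ container of class $j$ is $A_{i,j}$. A container is positive if its volume exceeds $\frac12$, otherwise negative. A bin has at most one positive and at most one negative container; a nonempty bin is *neutral* if it has both, *positive* if it has only a positive one, *negative* if it has only a negative one; a container alone in its bin is *unmatched*. Two containers fit if their volumes sum to at most $1$. Let $n_j$ and $n_{ij}$ be the current numbers of containers of class $j$, and of type $i$ of class $j$. Best Fit selects a container of largest volume among those that fit. Unspecified choices and ties are arbitrary. **Algorithm AH.** The next item, of class $j$, is packed as follows. *Huge item:* its new container goes, by Best Fit, into a negative bin where it fits, if there is one (a temporary type 1 container in that bin becomes regular type 1), otherwise into a new bin. *Small or tiny item:* if class $j$ has an open container, pack the item there. Otherwise open a new container of class $j$, whose type is the least $i$ with $\alpha_{ij}>0$ and $n_{ij}\le\lfloor\alpha_{ij}n_j\rfloor$. - If the new container is negative, pack it into a positive bin where it fits, if any. Otherwise, if for some class $j'$ there are temporary type 1 containers, $A_{2,j'}$ plus the volume of the new container is at most $1$, and $n_{2j'}\le\lfloor\alpha_{2j'}n_{j'}\rfloor-1$,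 choose such a class, pack the new container with a temporary type 1 container of class $j'$ of maximum volume, and make the latter a declared type 2 container. Otherwise use a new bin. - If the new container is positive, pack it into a negative bin where it fits and whose container is not temporary type 1, if any. Otherwise, if it fits with a temporary type 1 container of some class $j'$, choose such a class, pack the new container with one of maximum volume among those of class $j'$ that fit, and make the latter regular type 1. Otherwise use a new bin. *Large item:* if class $j$ has a declared type 2 container, add the item to it; it becomes regular type 2. Otherwise: - if $n_{2j}=\lfloor\alpha_{2j}n_j\rfloor$, the item forms a new type 1 container; if it fits into a positive bin, use Best Fit and make it regular type 1; otherwise it is a temporary type 1 container in a new bin; - if $n_{2j}<\lfloor\alpha_{2j}n_j\rfloor$: if some negative bin has a container of volume at most $1-A_{2,j}$, pack the item into such a bin as a declared type 2 container; otherwise, if class $j$ has temporary type 1 containers, add the item to one of largest volume, which becomes regular type 2; otherwise pack the item as a declared type 2 container into a new bin. **Scenarios.** For a nonempty input $I$ and an output of AH on $I$, let $a$ be the minimum of $1-s_{\min}/2$, where $s_{\min}$ is the smallest item size of $I$, and of the volumes of all unmatched positive containers of the output. Let $V'$ be the set of all elements of $\{A_{i,j},\,1-A_{i,j}: 2\le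 j\le M+1,\ \alpha_{ij}>0\}\cup\{t_1,\dots,t_{M+1}\}$ that are at most $\frac12$. A scenario is an interval $(x,y]$ between consecutive elements $x<y$ of $V'$; the output belongs to it if $1-a\in(x,y]$. Its threshold class is the $k$ with $(x,y]\subseteq(t_k,t_{k-1}]$; it is a large class exactly if $y>\frac13$. **Weights.** Given $w$, the required weight of a positive container is $1$ if its volume is at least $a$, and $w$ otherwise; that of a negative container is $1-w$ if its volume is at most $1-a$, and $1$ otherwise. Call a class $j\ge2$ basic unless it is large and $j=k$. For a basic class $j$ let $r(i,j)$ be the required weight of a type $i$ container of class $j$ (this depends only on $i,j$). The weight of an item is: for a huge item, $1$ if its size is at least $a$ and $w$ otherwise; for an item of a basic class $j\le M$, $\sum_i\alpha_{ij}r(i,j)\big/\sum_i i\,\alpha_{ij}$; for a tiny item, its size times $\sum_i\alpha_{i,M+1}r(i,M+1)\big/\sum_i(A_{i,M+1}-t_M)\alpha_{i,M+1}$; and, if $k$ is large, for an item of class $k$, $u$ if its size is at most $1-a$ and $v$ otherwise. Let $W$ be the total weight of the items of $I$. **Theorem.** There is a constant $\Psi$, depending only on the parameters, such that the following holds for every scenario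 $(x,y]$ with threshold class $k$, every $w\in[0,1]$ and, if $y>\frac13$, all $u,v\in[0,1]$ with $$u\le v,\qquad u(1+\alpha_{2k})+w\alpha_{1k}\ge1,\qquad u\alpha_{2k}+v\ge1,\qquad v\alpha_{1k}+2u\alpha_{2k}+(1-w)\alpha_{2k}\ge1$$ (if $y\le\frac13$, only $w\in[0,1]$ is required, and $u,v$ do not occur in the weights). For every input $I$ and every output of AH on $I$ that belongs to the scenario $(x,y]$, the number of bins of this output is at most $W+\Psi$. -/

import Mathlib

namespace AH

/-- The parameters of algorithm AH.  The boundary points are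
`1 = t 0 > t 1 = 1/2 > ⋯ > t b = 1/3 > ⋯ > t M > t (M+1) = 0` and the items of class `j` are those
with size in `(t j, t (j-1)]`: class `1` is huge, classes `2, …, b` are large, classes
`b+1, …, M` are small, class `M+1` is tiny.  `α i j` is the proportion of type `i` containers
among the containers of class `j`; `tinyCap i` is the bound `A_{i,M+1}` on the total size of the
items of a type `i` container of tiny items. -/
structure Params where
  M : ℕ
  b : ℕ
  p : ℕ
  t : ℕ → ℝ
  α : ℕ → ℕ → ℝ
  tinyCap : ℕ → ℝ
  b_le : b ≤ M
  one_le_p : 1 ≤ p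
  t_zero : t 0 = 1
  t_one : t 1 = 1 / 2
  t_b : t b = 1 / 3
  t_last : t (M + 1) = 0
  t_anti : ∀ j, j ≤ M → t (j + 1) < t j
  tinyCap_first : t M ≤ tinyCap 1
  tinyCap_mono : ∀ i, 1 ≤ i → i < p → tinyCap i < tinyCap (i + 1)
  tinyCap_last : tinyCap p ≤ 1
  /-- Proportions are nonnegative (types range over `1, …, γ_j`, where `γ_j = ⌊1 / t (j-1)⌋` for
  `j ≤ M` and `γ_{M+1} = p`). -/
  α_nonneg : ∀ j, 2 ≤ j → j ≤ M + 1 →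
    ∀ i ∈ Finset.Icc 1 (if j = M + 1 then p else ⌊1 / t (j - 1)⌋₊), 0 ≤ α i j
  α_sum : ∀ j, 2 ≤ j → j ≤ M + 1 →
    ∑ i ∈ Finset.Icc 1 (if j = M + 1 then p else ⌊1 / t (j - 1)⌋₊), α i j = 1
  α_large : ∀ j, 2 ≤ j → j ≤ b → 0 < α 2 j
  α_tiny : ∀ i ∈ Finset.Icc 1 p, 0 < α i (M + 1)
  /-- The denominator in the definition of the weight of tiny items does not vanish. -/
  tiny_denom_pos : 0 < ∑ i ∈ Finset.Icc 1 p, (tinyCap i - t M) * α i (M + 1)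

namespace Params

/-- The largest type `γ_j` of a container of class `j ≥ 2`. -/
noncomputable def γ (P : Params) (j : ℕ) : ℕ :=
  if j = P.M + 1 then P.p else ⌊1 / P.t (j - 1)⌋₊

/-- `A_{i,j}`. -/
noncomputable def A (P : Params) (i j : ℕ) : ℝ :=
  if j = P.M + 1 then P.tinyCap i else i * P.t (j - 1)

/-- The class of an item of size `s ∈ (0, 1]`, that is, the unique `j` with
`s ∈ (t j, t (j-1)]`. -/
noncomputable def classOf (P : Params) (s : ℝ) : ℕ := sInf {j | P.t j < s}

/-- The class of an item, characterised by its interval. -/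
theorem classOf_eq_iff (P : Params) {s : ℝ} {j : ℕ}
    (hj : 1 ≤ j) (hjM : j ≤ P.M + 1) :
    P.classOf s = j ↔ s ∈ Set.Ioc (P.t j) (P.t (j - 1)) := by
  have hanti : ∀ n, n ≤ P.M + 1 → ∀ m, m ≤ n → P.t n ≤ P.t m := by
    intro n hn m hm
    induction n, hm using Nat.le_induction with
    | base => exact le_rfl
    | succ n _ ih => exact (P.t_anti n (by omega)).le.trans (ih (by omega))
  constructor
  · intro h
    have hne : {j | P.t j < s}.Nonempty := by
      by_contra hc
      rw [Set.not_nonempty_iff_eq_empty] at hc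
      have : P.classOf s = 0 := by simp [classOf, hc]
      omega
    have hmem : P.t (P.classOf s) < s := Nat.sInf_mem hne
    refine ⟨h ▸ hmem, ?_⟩
    by_contra hc
    have : P.classOf s ≤ j - 1 := Nat.sInf_le (not_le.mp hc)
    omega
  · rintro ⟨h2, h3⟩
    refine le_antisymm (Nat.sInf_le h2) ?_
    by_contra hc
    have hmem : P.t (P.classOf s) < s := Nat.sInf_mem (s := {j | P.t j < s}) ⟨j, h2⟩
    have := hanti (j - 1) (by omega) (P.classOf s) (by omega)
    linarith

end Params

/-- The status of a container.  `fixed i` is a type `i` container of the huge class (with `i = 1`),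
of a small class or of the tiny class; the other four occur for large classes. -/
inductive Status
  | fixed (i : ℕ)
  | regular1
  | temporary1
  | declared2
  | regular2

/-- The type of a container with the given status. -/
def Status.type : Status → ℕ
  | .fixed i => i
  | .regular1 => 1
  | .temporary1 => 1
  | .declared2 => 2
  | .regular2 => 2

/-- A container: its class, its status, and the sizes of the items packed into it so far. -/
structure Container where
  cls : ℕ
  status : Status
  items : Multiset ℝ

/-- The volume of a container: the size of its unique item for type `1` containers of huge and
large classes, and `A_{i,j}` otherwise. -/
noncomputable def Container.volume (P : Params) (c : Container) : ℝ :=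
  if c.status.type = 1 ∧ c.cls ≤ P.b then c.items.sum else P.A c.status.type c.cls

/-- Two containers fit together if their total volume is at most `1`. -/
def Container.Fits (P : Params) (c d : Container) : Prop := c.volume P + d.volume P ≤ 1

/-- An open container of a small or tiny class. -/
def Container.IsOpen (P : Params) (c : Container) : Prop :=
  (P.b < c.cls ∧ c.cls ≤ P.M ∧ c.items.card < c.status.type) ∨
  (c.cls = P.M + 1 ∧ 0 < c.items.sum ∧ c.items.sum ≤ P.A c.status.type c.cls - P.t P.M)

/-- A nonempty bin: with a positive container only, with a negative container only, or
(`neutral c d`) with a positive container `c` and a negative container `d`. -/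
inductive Bin
  | positive (c : Container)
  | negative (d : Container)
  | neutral (c d : Container)

/-- The containers in a bin. -/
def Bin.containers : Bin → Multiset Container
  | .positive c => {c}
  | .negative d => {d}
  | .neutral c d => {c, d}

/-- `Replace c c' B B'`: the bin `B'` arises from the bin `B` by replacing its container `c`
by `c'` (which has the same sign). -/
inductive Replace (c c' : Container) : Bin → Bin → Prop
  | positive : Replace c c' (.positive c) (.positive c')
  | negative : Replace c c' (.negative c) (.negative c')
  | neutralPos (d : Container) : Replace c c' (.neutral c d) (.neutral c' d)
  | neutralNeg (e : Container) : Replace c c' (.neutral e c) (.neutral e c')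

/-- A packing: the multiset of the nonempty bins. -/
abbrev Packing := Multiset Bin

/-- All containers of a packing. -/
def Packing.containers (σ : Packing) : Multiset Container := σ.bind Bin.containers

/-- `n_j`, the number of containers of class `j`. -/
def Packing.num (σ : Packing) (j : ℕ) : ℕ :=
  (Packing.containers σ).countP (fun c => c.cls = j)

/-- `n_{ij}`, the number of type `i` containers of class `j`. -/
def Packing.numType (σ : Packing) (i j : ℕ) : ℕ :=
  (Packing.containers σ).countP (fun c => c.cls = j ∧ c.status.type = i)

/-- A type `i` that has `α_{ij} > 0` and `n_{ij} ≤ ⌊α_{ij} n_j⌋`. -/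
def Eligible (P : Params) (σ : Packing) (j i : ℕ) : Prop :=
  1 ≤ i ∧ i ≤ P.γ j ∧ 0 < P.α i j ∧
    Packing.numType σ i j ≤ ⌊P.α i j * (Packing.num σ j : ℝ)⌋₊

/-- A new container for a small or tiny item of size `s` is opened in the packing `σ`, and `c` is
this container: there is no open container of the class, and the type is the least eligible one. -/
def Opens (P : Params) (s : ℝ) (σ : Packing) (c : Container) : Prop :=
  P.b < P.classOf s ∧
  (∀ d ∈ Packing.containers σ, d.cls = P.classOf s → ¬ d.IsOpen P) ∧
  ∃ i, Eligible P σ (P.classOf s) i ∧ (∀ i' < i, ¬ Eligible P σ (P.classOf s) i') ∧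
    c = ⟨P.classOf s, .fixed i, {s}⟩

/-- The item of size `s` is of a large class `j` and there is no declared type 2 container of
class `j`. -/
def LargeNoDeclared (P : Params) (s : ℝ) (σ : Packing) (j : ℕ) : Prop :=
  P.classOf s = j ∧ 2 ≤ j ∧ j ≤ P.b ∧
    ∀ c ∈ Packing.containers σ, c.cls = j → c.status ≠ .declared2

/-- The bound `⌊α_{2j} n_j⌋` on the number of type 2 containers of a large class `j`. -/
noncomputable def type2Bound (P : Params) (σ : Packing) (j : ℕ) : ℕ :=
  ⌊P.α 2 j * (Packing.num σ j : ℝ)⌋₊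

/-- A temporary type 1 container `d` (alone in its bin) can be turned into a declared type 2
container that is packed together with the new negative container `c`. -/
def Convertible (P : Params) (σ : Packing) (c d : Container) : Prop :=
  d.status = .temporary1 ∧ P.A 2 d.cls + c.volume P ≤ 1 ∧
    Packing.numType σ 2 d.cls + 1 ≤ type2Bound P σ d.cls

/-- A temporary type 1 container that is joined by a positive container becomes a regular type 1
container; other containers do not change. -/
def Container.joined (d : Container) : Container :=
  match d.status with
  | .temporary1 => { d with status := .regular1 }
  | _ => d

/-- `Step P s σ σ'`: algorithm AH may pack the next item, of size `s`, so that the packing `σ`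
becomes `σ'`.  Arbitrary choices of the algorithm are nondeterministic. -/
inductive Step (P : Params) (s : ℝ) : Packing → Packing → Prop
  /-- A huge item, packed by Best Fit into a negative bin. -/
  | hugeFit (c d : Container) (σ : Packing) (hs : P.classOf s = 1)
      (hc : c = ⟨1, .fixed 1, {s}⟩) (hd : c.Fits P d)
      (hbest : ∀ d', Bin.negative d' ∈ σ → c.Fits P d' → d'.volume P ≤ d.volume P) :
      Step P s (Bin.negative d ::ₘ σ) (Bin.neutral c d.joined ::ₘ σ)
  /-- A huge item, packed into a new bin. -/
  | hugeNew (c : Container) (σ : Packing) (hs : P.classOf s = 1)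
      (hc : c = ⟨1, .fixed 1, {s}⟩)
      (hno : ∀ d, Bin.negative d ∈ σ → ¬ c.Fits P d) :
      Step P s σ (Bin.positive c ::ₘ σ)
  /-- A small or tiny item, packed into the open container of its class. -/
  | intoOpen (c : Container) (B B' : Bin) (σ : Packing) (hs : P.b < P.classOf s)
      (hc : c.cls = P.classOf s) (ho : c.IsOpen P)
      (hB : Replace c { c with items := s ::ₘ c.items } B B') :
      Step P s (B ::ₘ σ) (B' ::ₘ σ)
  /-- A new negative container of small or tiny items, packed into a positive bin. -/
  | negFit (c d : Container) (σ : Packing) (hc : Opens P s (Bin.positive d ::ₘ σ) c)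
      (hneg : c.volume P ≤ 1 / 2) (hd : d.Fits P c) :
      Step P s (Bin.positive d ::ₘ σ) (Bin.neutral d c ::ₘ σ)
  /-- A new negative container of small or tiny items, packed with a temporary type 1 container
  (of maximum volume in its class) that becomes a declared type 2 container. -/
  | negTemporary (c d : Container) (σ : Packing) (hc : Opens P s (Bin.negative d ::ₘ σ) c)
      (hneg : c.volume P ≤ 1 / 2)
      (hno : ∀ e, Bin.positive e ∈ σ → ¬ e.Fits P c)
      (hd : Convertible P (Bin.negative d ::ₘ σ) c d)
      (hbest : ∀ d', Bin.negative d' ∈ σ → d'.status = .temporary1 → d'.cls = d.cls →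
        d'.volume P ≤ d.volume P) :
      Step P s (Bin.negative d ::ₘ σ)
        (Bin.neutral { d with status := .declared2 } c ::ₘ σ)
  /-- A new negative container of small or tiny items, packed into a new bin. -/
  | negNew (c : Container) (σ : Packing) (hc : Opens P s σ c)
      (hneg : c.volume P ≤ 1 / 2)
      (hno : ∀ e, Bin.positive e ∈ σ → ¬ e.Fits P c)
      (hno' : ∀ d, Bin.negative d ∈ σ → ¬ Convertible P σ c d) :
      Step P s σ (Bin.negative c ::ₘ σ)
  /-- A new positive container of small or tiny items, packed into a negative bin whose container
  is not a temporary type 1 container. -/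
  | posFit (c d : Container) (σ : Packing) (hc : Opens P s (Bin.negative d ::ₘ σ) c)
      (hpos : 1 / 2 < c.volume P) (ht : d.status ≠ .temporary1) (hd : c.Fits P d) :
      Step P s (Bin.negative d ::ₘ σ) (Bin.neutral c d ::ₘ σ)
  /-- A new positive container of small or tiny items, packed with a temporary type 1 container
  (of maximum volume among those of its class that fit) that becomes a regular type 1 container. -/
  | posTemporary (c d : Container) (σ : Packing) (hc : Opens P s (Bin.negative d ::ₘ σ) c)
      (hpos : 1 / 2 < c.volume P)
      (hno : ∀ e, Bin.negative e ∈ σ → e.status ≠ .temporary1 → ¬ c.Fits P e)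
      (ht : d.status = .temporary1) (hd : c.Fits P d)
      (hbest : ∀ d', Bin.negative d' ∈ σ → d'.status = .temporary1 → d'.cls = d.cls →
        c.Fits P d' → d'.volume P ≤ d.volume P) :
      Step P s (Bin.negative d ::ₘ σ)
        (Bin.neutral c { d with status := .regular1 } ::ₘ σ)
  /-- A new positive container of small or tiny items, packed into a new bin. -/
  | posNew (c : Container) (σ : Packing) (hc : Opens P s σ c)
      (hpos : 1 / 2 < c.volume P)
      (hno : ∀ d, Bin.negative d ∈ σ → ¬ c.Fits P d) :
      Step P s σ (Bin.positive c ::ₘ σ)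
  /-- A large item, packed into a declared type 2 container of its class. -/
  | largeDeclared (c : Container) (B B' : Bin) (σ : Packing)
      (hs : 2 ≤ P.classOf s ∧ P.classOf s ≤ P.b)
      (hc : c.cls = P.classOf s) (hdecl : c.status = .declared2)
      (hB : Replace c { c with status := .regular2, items := s ::ₘ c.items } B B') :
      Step P s (B ::ₘ σ) (B' ::ₘ σ)
  /-- A large item as a new regular type 1 container, packed by Best Fit into a positive bin. -/
  | largeOneFit (j : ℕ) (c d : Container) (σ : Packing)
      (hj : LargeNoDeclared P s (Bin.positive d ::ₘ σ) j)
      (hn : Packing.numType (Bin.positive d ::ₘ σ) 2 j = type2Bound P (Bin.positive d ::ₘ σ) j)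
      (hc : c = ⟨j, .regular1, {s}⟩) (hd : d.Fits P c)
      (hbest : ∀ d', Bin.positive d' ∈ σ → d'.Fits P c → d'.volume P ≤ d.volume P) :
      Step P s (Bin.positive d ::ₘ σ) (Bin.neutral d c ::ₘ σ)
  /-- A large item as a temporary type 1 container in a new bin. -/
  | largeOneNew (j : ℕ) (c : Container) (σ : Packing)
      (hj : LargeNoDeclared P s σ j)
      (hn : Packing.numType σ 2 j = type2Bound P σ j)
      (hc : c = ⟨j, .temporary1, {s}⟩)
      (hno : ∀ d, Bin.positive d ∈ σ → ¬ d.Fits P c) :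
      Step P s σ (Bin.negative c ::ₘ σ)
  /-- A large item in a new declared type 2 container, packed into a negative bin. -/
  | largeTwoFit (j : ℕ) (c d : Container) (σ : Packing)
      (hj : LargeNoDeclared P s (Bin.negative d ::ₘ σ) j)
      (hn : Packing.numType (Bin.negative d ::ₘ σ) 2 j < type2Bound P (Bin.negative d ::ₘ σ) j)
      (hc : c = ⟨j, .declared2, {s}⟩) (hd : c.Fits P d) :
      Step P s (Bin.negative d ::ₘ σ) (Bin.neutral c d ::ₘ σ)
  /-- A large item, added to the temporary type 1 container of its class of maximum volume, which
  becomes a regular type 2 container. -/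
  | largeTwoTemporary (j : ℕ) (c d : Container) (σ : Packing)
      (hj : LargeNoDeclared P s (Bin.negative d ::ₘ σ) j)
      (hn : Packing.numType (Bin.negative d ::ₘ σ) 2 j < type2Bound P (Bin.negative d ::ₘ σ) j)
      (hd : d.cls = j) (ht : d.status = .temporary1)
      (hc : c = ⟨j, .regular2, s ::ₘ d.items⟩)
      (hno : ∀ e, Bin.negative e ∈ Bin.negative d ::ₘ σ → ¬ c.Fits P e)
      (hbest : ∀ d', Bin.negative d' ∈ σ → d'.status = .temporary1 → d'.cls = j →
        d'.volume P ≤ d.volume P) :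
      Step P s (Bin.negative d ::ₘ σ) (Bin.positive c ::ₘ σ)
  /-- A large item in a new declared type 2 container, packed into a new bin. -/
  | largeTwoNew (j : ℕ) (c : Container) (σ : Packing)
      (hj : LargeNoDeclared P s σ j)
      (hn : Packing.numType σ 2 j < type2Bound P σ j)
      (hc : c = ⟨j, .declared2, {s}⟩)
      (hno : ∀ d, Bin.negative d ∈ σ → ¬ c.Fits P d)
      (hno' : ∀ d, Bin.negative d ∈ σ → d.cls = j → d.status ≠ .temporary1) :
      Step P s σ (Bin.positive c ::ₘ σ)

/-- `Run P I σ`: the packing `σ` is a possible output of AH on the input sequence `I`. -/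
inductive Run (P : Params) : List ℝ → Packing → Prop
  | nil : Run P [] 0
  | snoc (I : List ℝ) (s : ℝ) (σ σ' : Packing) (hI : Run P I σ) (hs : Step P s σ σ') :
      Run P (I ++ [s]) σ'

/-- `a` is the minimum of `1 - s_min / 2`, where `s_min` is the least item size of the input, and
of the volumes of the unmatched positive containers of the output. -/
def IsThreshold (P : Params) (I : List ℝ) (σ : Packing) (a : ℝ) : Prop :=
  ∃ smin, IsLeast {s | s ∈ I} smin ∧
    IsLeast (insert (1 - smin / 2) {r | ∃ c, Bin.positive c ∈ σ ∧ r = c.volume P}) a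

/-- The set `V'` of the values at most `1/2` among all `A_{i,j}`, `1 - A_{i,j}` with
`2 ≤ j ≤ M+1` and `α_{ij} > 0`, and all `t_1, …, t_{M+1}`. -/
def scenarioPoints (P : Params) : Set ℝ :=
  {z | z ≤ 1 / 2 ∧
    ((∃ i j, 2 ≤ j ∧ j ≤ P.M + 1 ∧ 1 ≤ i ∧ i ≤ P.γ j ∧ 0 < P.α i j ∧
        (z = P.A i j ∨ z = 1 - P.A i j)) ∨
      ∃ j, 1 ≤ j ∧ j ≤ P.M + 1 ∧ z = P.t j)}

/-- `(x, y]` is a scenario: `x < y` are consecutive elements of `V'`. -/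
def IsScenario (P : Params) (x y : ℝ) : Prop :=
  x ∈ scenarioPoints P ∧ y ∈ scenarioPoints P ∧ x < y ∧
    Disjoint (Set.Ioo x y) (scenarioPoints P)

/-- `k` is the threshold class of the scenario `(x, y]`. -/
def IsThresholdClass (P : Params) (x y : ℝ) (k : ℕ) : Prop :=
  1 ≤ k ∧ k ≤ P.M + 1 ∧ Set.Ioc x y ⊆ Set.Ioc (P.t k) (P.t (k - 1))

/-- The required weight of a container of volume `vol`.  Positive containers require `1` if
`vol ≥ a` and `w` otherwise; negative ones require `1 - w` if `vol ≤ 1 - a` and `1` otherwise. -/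
noncomputable def required (a w vol : ℝ) : ℝ :=
  if 1 / 2 < vol then (if a ≤ vol then 1 else w) else (if vol ≤ 1 - a then 1 - w else 1)

/-- The required weight `r(i,j)` of a type `i` container of a basic class `j`.  For a type 1
container of a basic large class the volume is not `A_{1,j} = t (j-1)` but the size of its item;
both lie on the same side of `1 - a`, as `1 - a` is not in `(t j, t (j-1)]`. -/
noncomputable def requiredType (P : Params) (a w : ℝ) (i j : ℕ) : ℝ :=
  required a w (P.A i j)

/-- The weight `ω_j` of every item of a basic class `j ≤ M`. -/
noncomputable def classWeight (P : Params) (a w : ℝ) (j : ℕ) : ℝ :=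
  (∑ i ∈ Finset.Icc 1 (P.γ j), P.α i j * requiredType P a w i j) /
    ∑ i ∈ Finset.Icc 1 (P.γ j), (i : ℝ) * P.α i j

/-- The weight per unit of size `ρ` of the tiny items. -/
noncomputable def tinyDensity (P : Params) (a w : ℝ) : ℝ :=
  (∑ i ∈ Finset.Icc 1 P.p, P.α i (P.M + 1) * requiredType P a w i (P.M + 1)) /
    ∑ i ∈ Finset.Icc 1 P.p, (P.A i (P.M + 1) - P.t P.M) * P.α i (P.M + 1)

/-- The weight of an item of size `s`, for the threshold class `k` and the values `a, u, v, w`. -/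
noncomputable def itemWeight (P : Params) (a : ℝ) (k : ℕ) (u v w s : ℝ) : ℝ :=
  if P.classOf s = 1 then (if a ≤ s then 1 else w)
  else if P.classOf s = k ∧ k ≤ P.b then (if s ≤ 1 - a then u else v)
  else if P.classOf s = P.M + 1 then s * tinyDensity P a w
  else classWeight P a w (P.classOf s)

/-- The total weight `W` of the items of the input. -/
noncomputable def totalWeight (P : Params) (a : ℝ) (k : ℕ) (u v w : ℝ) (I : List ℝ) : ℝ :=
  (I.map (itemWeight P a k u v w)).sum

end AH

namespace AH

open Multiset

namespace Params

variable (P : Params)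

theorem t_le_of_le {m n : ℕ} (hmn : m ≤ n) (hn : n ≤ P.M + 1) : P.t n ≤ P.t m := by
  induction n, hmn using Nat.le_induction with
  | base => exact le_rfl
  | succ n _ ih => exact (P.t_anti n (by omega)).le.trans (ih (by omega))

theorem t_lt_of_lt {m n : ℕ} (hmn : m < n) (hn : n ≤ P.M + 1) : P.t n < P.t m :=
  (P.t_le_of_le (Nat.succ_le_of_lt hmn) hn).trans_lt (P.t_anti m (by omega))

theorem two_le_b : 2 ≤ P.b := by
  by_contra h
  have hb := P.t_b
  have h0 := P.t_zero
  have h1 := P.t_one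
  have : P.b = 0 ∨ P.b = 1 := by omega
  rcases this with h | h <;> rw [h] at hb <;> norm_num [h0, h1] at hb

theorem classOf_mem {s : ℝ} (h0 : 0 < s) (h1 : s ≤ 1) :
    1 ≤ P.classOf s ∧ P.classOf s ≤ P.M + 1 := by
  have hM : P.M + 1 ∈ {j | P.t j < s} := by simp [P.t_last, h0]
  refine ⟨?_, Nat.sInf_le hM⟩
  by_contra hc
  have hmem : P.t (P.classOf s) < s := Nat.sInf_mem (s := {j | P.t j < s}) ⟨_, hM⟩
  have : P.classOf s = 0 := by omega
  rw [this, P.t_zero] at hmem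
  linarith

theorem mem_Ioc_of_classOf {s : ℝ} (h0 : 0 < s) (h1 : s ≤ 1) :
    s ∈ Set.Ioc (P.t (P.classOf s)) (P.t (P.classOf s - 1)) :=
  (P.classOf_eq_iff (P.classOf_mem h0 h1).1 (P.classOf_mem h0 h1).2).1 rfl

theorem t_large {j : ℕ} (h2 : 2 ≤ j) (hb : j ≤ P.b) :
    1 / 3 < P.t (j - 1) ∧ P.t (j - 1) ≤ 1 / 2 := by
  have := P.b_le
  refine ⟨?_, ?_⟩
  · rw [← P.t_b]; exact P.t_lt_of_lt (by omega) (by omega)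
  · rw [← P.t_one]; exact P.t_le_of_le (by omega) (by omega)

theorem t_nonneg {j : ℕ} (h : j ≤ P.M + 1) : 0 ≤ P.t j := by
  rw [← P.t_last]; exact P.t_le_of_le h le_rfl

theorem A_two_large {j : ℕ} (hb : j ≤ P.b) : P.A 2 j = 2 * P.t (j - 1) := by
  have := P.b_le
  rw [A, if_neg (by omega)]; norm_num

theorem half_lt_A_two {j : ℕ} (h2 : 2 ≤ j) (hb : j ≤ P.b) : 1 / 2 < P.A 2 j := by
  rw [P.A_two_large hb]
  linarith [(P.t_large h2 hb).1]

theorem gamma_large {j : ℕ} (h2 : 2 ≤ j) (hb : j ≤ P.b) : P.γ j = 2 := by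
  have := P.b_le
  obtain ⟨h3, h4⟩ := P.t_large h2 hb
  rw [γ, if_neg (by omega), Nat.floor_eq_iff (by positivity)]
  constructor
  · rw [le_div_iff₀ (by linarith)]; push_cast; linarith
  · rw [div_lt_iff₀ (by linarith)]; push_cast; linarith

theorem alpha_sum {j : ℕ} (h2 : 2 ≤ j) (hj : j ≤ P.M + 1) :
    ∑ i ∈ Finset.Icc 1 (P.γ j), P.α i j = 1 := P.α_sum j h2 hj

theorem alpha_nonneg {i j : ℕ} (h2 : 2 ≤ j) (hj : j ≤ P.M + 1) (hi : i ∈ Finset.Icc 1 (P.γ j)) :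
    0 ≤ P.α i j := P.α_nonneg j h2 hj i hi

theorem alpha_add {j : ℕ} (h2 : 2 ≤ j) (hb : j ≤ P.b) : P.α 1 j + P.α 2 j = 1 := by
  have hbM := P.b_le
  have h := P.alpha_sum h2 (by omega)
  rw [P.gamma_large h2 hb] at h
  simpa [Finset.sum_Icc_succ_top] using h

theorem alpha_one_nonneg {j : ℕ} (h2 : 2 ≤ j) (hb : j ≤ P.b) : 0 ≤ P.α 1 j := by
  have hbM := P.b_le
  exact P.alpha_nonneg h2 (by omega) (by rw [P.gamma_large h2 hb]; simp)

theorem tinyCap_le {i : ℕ} (h1 : 1 ≤ i) (hp : i ≤ P.p) : P.t P.M ≤ P.tinyCap i := by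
  induction i, h1 using Nat.le_induction with
  | base => exact P.tinyCap_first
  | succ n hn ih => exact (ih (by omega)).trans (P.tinyCap_mono n hn (by omega)).le

end Params

/-- The status of a container is consistent with its class and its number of items. -/
def Container.StatusOK (P : Params) (c : Container) : Prop :=
  (c.cls = 1 ∧ c.status = .fixed 1 ∧ c.items.card = 1) ∨
  (2 ≤ c.cls ∧ c.cls ≤ P.b ∧
    (c.items.card = 1 ∧ (c.status = .regular1 ∨ c.status = .temporary1 ∨ c.status = .declared2) ∨
      c.items.card = 2 ∧ c.status = .regular2)) ∨
  (P.b < c.cls ∧ ∃ i, c.status = .fixed i ∧ 1 ≤ i ∧ i ≤ P.γ c.cls)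

/-- A container that can occur in a packing of AH. -/
structure Container.WF (P : Params) (c : Container) : Prop where
  ne_zero : c.items ≠ 0
  items : ∀ s ∈ c.items, 0 < s ∧ s ≤ 1 ∧ P.classOf s = c.cls
  statusOK : c.StatusOK P

namespace Container

variable {P : Params} {c d : Container} {s : ℝ}

theorem WF.cls_mem (h : c.WF P) : 1 ≤ c.cls ∧ c.cls ≤ P.M + 1 := by
  obtain ⟨s, hs⟩ := exists_mem_of_ne_zero h.ne_zero
  obtain ⟨h0, h1, h2⟩ := h.items s hs
  rw [← h2]
  exact P.classOf_mem h0 h1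

theorem WF.item_mem_Ioc (h : c.WF P) (hs : s ∈ c.items) :
    s ∈ Set.Ioc (P.t c.cls) (P.t (c.cls - 1)) := by
  obtain ⟨h0, h1, h2⟩ := h.items s hs
  rw [← h2]
  exact P.mem_Ioc_of_classOf h0 h1

theorem volume_of_small (h : P.b < c.cls) : c.volume P = P.A c.status.type c.cls := by
  rw [volume, if_neg (by omega)]

theorem volume_of_type_two (h : c.status.type = 2) : c.volume P = P.A 2 c.cls := by
  rw [volume, if_neg (by omega), h]

theorem volume_of_type_one (h : c.status.type = 1) (hb : c.cls ≤ P.b) :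
    c.volume P = c.items.sum := by
  rw [volume, if_pos ⟨h, hb⟩]

theorem half_lt_volume_of_type_two (h2 : 2 ≤ c.cls) (hb : c.cls ≤ P.b)
    (h : c.status.type = 2) : 1 / 2 < c.volume P := by
  rw [volume_of_type_two h]
  exact P.half_lt_A_two h2 hb

theorem WF.type_large (h : c.WF P) (h2 : 2 ≤ c.cls) (hb : c.cls ≤ P.b) :
    c.status.type = 1 ∨ c.status.type = 2 := by
  rcases h.statusOK with h | ⟨-, -, ⟨-, h | h | h⟩ | ⟨-, h⟩⟩ | h
  · omega
  all_goals first | (rw [h]; simp [Status.type]) | omega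

/-- A type `1` container of the huge class or of a large class holds one item. -/
theorem WF.exists_item (h : c.WF P) (hb : c.cls ≤ P.b) (h1 : c.status.type = 1) :
    ∃ s, c.items = {s} ∧ c.volume P = s ∧ s ∈ Set.Ioc (P.t c.cls) (P.t (c.cls - 1)) := by
  have hcard : c.items.card = 1 := by
    rcases h.statusOK with h | ⟨-, -, ⟨h, -⟩ | ⟨-, h⟩⟩ | h
    · exact h.2.2
    · exact h
    · rw [h] at h1; simp [Status.type] at h1
    · omega
  obtain ⟨s, hs⟩ := card_eq_one.1 hcard
  refine ⟨s, hs, ?_, h.item_mem_Ioc (by simp [hs])⟩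
  rw [volume_of_type_one h1 hb, hs, sum_singleton]

theorem WF.volume_large_one (h : c.WF P) (h2 : 2 ≤ c.cls) (hb : c.cls ≤ P.b)
    (h1 : c.status.type = 1) : 1 / 3 < c.volume P ∧ c.volume P ≤ 1 / 2 := by
  obtain ⟨s, -, hv, hs1, hs2⟩ := h.exists_item hb h1
  have hbM := P.b_le
  rw [hv]
  have h3 : 1 / 3 ≤ P.t c.cls := by
    rw [← P.t_b]; exact P.t_le_of_le hb (by omega)
  exact ⟨h3.trans_lt hs1, hs2.trans (P.t_large h2 hb).2⟩

theorem WF.type_of_half_lt (h : c.WF P) (h2 : 2 ≤ c.cls) (hb : c.cls ≤ P.b)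
    (hv : 1 / 2 < c.volume P) : c.status.type = 2 := by
  rcases h.type_large h2 hb with h1 | h1
  · linarith [(h.volume_large_one h2 hb h1).2]
  · exact h1

theorem WF.type_of_le_half (h : c.WF P) (h2 : 2 ≤ c.cls) (hb : c.cls ≤ P.b)
    (hv : c.volume P ≤ 1 / 2) : c.status.type = 1 := by
  rcases h.type_large h2 hb with h1 | h1
  · exact h1
  · linarith [half_lt_volume_of_type_two h2 hb h1]

theorem WF.large_of_status (h : c.WF P) (hs : ∀ i, c.status ≠ .fixed i) :
    2 ≤ c.cls ∧ c.cls ≤ P.b := by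
  rcases h.statusOK with ⟨-, h, -⟩ | ⟨h2, hb, -⟩ | ⟨-, i, h, -⟩
  · exact absurd h (hs _)
  · exact ⟨h2, hb⟩
  · exact absurd h (hs _)

theorem WF.volume_huge (h : c.WF P) (h1 : c.cls = 1) :
    c.status = .fixed 1 ∧ ∃ s, c.items = {s} ∧ c.volume P = s ∧ 1 / 2 < s := by
  have hb := P.two_le_b
  have hst : c.status = .fixed 1 := by
    rcases h.statusOK with h | h | h
    · exact h.2.1
    · omega
    · omega
  obtain ⟨s, h2, h3, h4⟩ := h.exists_item (by omega) (by rw [hst]; rfl)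
  rw [h1, P.t_one] at h4
  exact ⟨hst, s, h2, h3, h4.1⟩

/-- A container with one item of class `j`. -/
theorem wf_single {j : ℕ} {st : Status} (h0 : 0 < s) (h1 : s ≤ 1) (hj : P.classOf s = j)
    (hst : StatusOK P ⟨j, st, {s}⟩) : WF P ⟨j, st, {s}⟩ :=
  ⟨by simp, by simp [h0, h1, hj], hst⟩

theorem wf_large {j : ℕ} {st : Status} (h0 : 0 < s) (h1 : s ≤ 1) (hj : P.classOf s = j)
    (h2 : 2 ≤ j) (hb : j ≤ P.b) (hst : st = .regular1 ∨ st = .temporary1 ∨ st = .declared2) :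
    WF P ⟨j, st, {s}⟩ :=
  wf_single h0 h1 hj (Or.inr (Or.inl ⟨h2, hb, Or.inl ⟨by simp, hst⟩⟩))

theorem wf_huge (h0 : 0 < s) (h1 : s ≤ 1) (hj : P.classOf s = 1) : WF P ⟨1, .fixed 1, {s}⟩ :=
  wf_single h0 h1 hj (Or.inl ⟨rfl, rfl, by simp⟩)

theorem WF.addItem (h : c.WF P) {st : Status} (h0 : 0 < s) (h1 : s ≤ 1)
    (hj : P.classOf s = c.cls) (hst : StatusOK P ⟨c.cls, st, s ::ₘ c.items⟩) :
    WF P ⟨c.cls, st, s ::ₘ c.items⟩ :=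
  ⟨by simp, by simpa [h0, h1, hj] using h.items, hst⟩

theorem WF.setStatus (h : c.WF P) {st : Status} (hst : StatusOK P { c with status := st }) :
    WF P { c with status := st } :=
  ⟨h.ne_zero, h.items, hst⟩

/-- The properties of a temporary type `1` container. -/
theorem WF.temporary (h : c.WF P) (ht : c.status = .temporary1) :
    2 ≤ c.cls ∧ c.cls ≤ P.b ∧ c.items.card = 1 := by
  obtain ⟨h2, hb⟩ := h.large_of_status (by simp [ht])
  refine ⟨h2, hb, ?_⟩
  rcases h.statusOK with h | ⟨-, -, ⟨h, -⟩ | ⟨-, h⟩⟩ | h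
  · exact h.2.2
  · exact h
  · rw [h] at ht; simp at ht
  · omega

theorem WF.setStatus_temporary (h : c.WF P) (ht : c.status = .temporary1) {st : Status}
    (hst : st = .regular1 ∨ st = .temporary1 ∨ st = .declared2) :
    WF P { c with status := st } := by
  obtain ⟨h2, hb, hc⟩ := h.temporary ht
  exact h.setStatus (Or.inr (Or.inl ⟨h2, hb, Or.inl ⟨hc, hst⟩⟩))

theorem wf_of_opens {σ : Packing} (h0 : 0 < s) (h1 : s ≤ 1) (h : Opens P s σ c) : c.WF P := by
  obtain ⟨hb, -, i, hi, -, rfl⟩ := h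
  exact wf_single h0 h1 rfl (Or.inr (Or.inr ⟨hb, i, rfl, hi.1, hi.2.1⟩))

theorem WF.addOpen (h : c.WF P) (h0 : 0 < s) (h1 : s ≤ 1)
    (hj : c.cls = P.classOf s) (hb : P.b < c.cls) : WF P { c with items := s ::ₘ c.items } := by
  refine h.addItem h0 h1 hj.symm ?_
  rcases h.statusOK with h | h | h
  · have := P.two_le_b; omega
  · omega
  · exact Or.inr (Or.inr h)

theorem volume_addOpen (hb : P.b < c.cls) :
    volume P { c with items := s ::ₘ c.items } = c.volume P := by
  rw [volume_of_small hb, volume_of_small (c := { c with items := s ::ₘ c.items }) hb]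

theorem WF.addSecond (h : c.WF P) (h0 : 0 < s) (h1 : s ≤ 1) (hj : c.cls = P.classOf s)
    (hd : c.status = .declared2) : WF P ⟨c.cls, .regular2, s ::ₘ c.items⟩ := by
  obtain ⟨h2, hb⟩ := h.large_of_status (by simp [hd])
  refine h.addItem h0 h1 hj.symm (Or.inr (Or.inl ⟨h2, hb, Or.inr ⟨?_, rfl⟩⟩))
  rcases h.statusOK with h | ⟨-, -, ⟨h, -⟩ | ⟨-, h⟩⟩ | h
  · omega
  · simp [h]
  · rw [hd] at h; simp at h
  · omega

theorem WF.addTemporary (h : c.WF P) (h0 : 0 < s) (h1 : s ≤ 1) (hj : P.classOf s = c.cls)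
    (ht : c.status = .temporary1) : WF P ⟨c.cls, .regular2, s ::ₘ c.items⟩ := by
  obtain ⟨h2, hb, hc⟩ := h.temporary ht
  exact h.addItem h0 h1 hj (Or.inr (Or.inl ⟨h2, hb, Or.inr ⟨by simp [hc], rfl⟩⟩))

theorem joined_of_temporary (h : d.status = .temporary1) :
    d.joined = { d with status := .regular1 } := by
  simp [joined, h]

theorem joined_of_ne (h : d.status ≠ .temporary1) : d.joined = d := by
  unfold joined
  split
  · contradiction
  · rfl

@[simp] theorem joined_cls : d.joined.cls = d.cls := by
  unfold joined; split <;> rfl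

@[simp] theorem joined_items : d.joined.items = d.items := by
  unfold joined; split <;> rfl

@[simp] theorem joined_type : d.joined.status.type = d.status.type := by
  unfold joined; split
  · rename_i h; simp [h, Status.type]
  · rfl

@[simp] theorem joined_volume : d.joined.volume P = d.volume P := by
  simp [volume]

theorem joined_ne_temporary : d.joined.status ≠ .temporary1 := by
  unfold joined; split
  · simp
  · assumption

theorem joined_declared : d.joined.status = .declared2 ↔ d.status = .declared2 := by
  unfold joined; split
  · rename_i h; simp [h]
  · rfl

theorem WF.joined (h : d.WF P) : d.joined.WF P := by
  by_cases ht : d.status = .temporary1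
  · rw [joined_of_temporary ht]
    exact h.setStatus_temporary ht (by simp)
  · rwa [joined_of_ne ht]

end Container

/-- A bin that can occur in a packing of AH. -/
def Bin.WF (P : Params) : Bin → Prop
  | .positive c => c.WF P ∧ 1 / 2 < c.volume P
  | .negative d => d.WF P ∧ d.volume P ≤ 1 / 2 ∧ d.status ≠ .regular1
  | .neutral c d => c.WF P ∧ 1 / 2 < c.volume P ∧ d.WF P ∧ d.volume P ≤ 1 / 2 ∧
      d.status ≠ .temporary1

theorem Replace.wf {P : Params} {c c' : Container} {B B' : Bin} (h : Replace c c' B B')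
    (hB : B.WF P) (hc : c.WF P → c'.WF P) (hv : c'.volume P = c.volume P)
    (hs : (c'.status = c.status) ∨ c'.status = .regular2) : B'.WF P := by
  have h1 : c.status ≠ .regular1 → c'.status ≠ .regular1 := by
    rcases hs with h | h <;> simp [h]
  have h2 : c.status ≠ .temporary1 → c'.status ≠ .temporary1 := by
    rcases hs with h | h <;> simp [h]
  cases h <;> simp only [Bin.WF] at hB ⊢ <;> simp only [hv] <;> tauto

theorem Bin.WF.container_wf {P : Params} {B : Bin} (h : B.WF P) {c : Container}
    (hc : c ∈ B.containers) : c.WF P := by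
  cases B <;> simp only [Bin.containers, Bin.WF, Multiset.mem_singleton, Multiset.insert_eq_cons,
    Multiset.mem_cons] at h hc
  · rw [hc]; exact h.1
  · rw [hc]; exact h.1
  · rcases hc with rfl | rfl
    · exact h.1
    · exact h.2.2.1

theorem Step.wf {P : Params} {s : ℝ} {σ σ' : Packing} (h0 : 0 < s) (h1 : s ≤ 1)
    (h : Step P s σ σ') (hσ : ∀ B ∈ σ, B.WF P) : ∀ B ∈ σ', B.WF P := by
  cases h with
  | hugeFit c d σ hs hc hd hbest =>
    rw [forall_mem_cons] at hσ ⊢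
    obtain ⟨⟨hdw, hdv, -⟩, hσ⟩ := hσ
    have hcw : c.WF P := hc ▸ Container.wf_huge h0 h1 hs
    obtain ⟨-, r, -, hr, hr'⟩ := hcw.volume_huge (by rw [hc])
    exact ⟨⟨hcw, hr ▸ hr', hdw.joined, by simpa using hdv, Container.joined_ne_temporary⟩, hσ⟩
  | hugeNew c σ hs hc hno =>
    rw [forall_mem_cons]
    have hcw : c.WF P := hc ▸ Container.wf_huge h0 h1 hs
    obtain ⟨-, r, -, hr, hr'⟩ := hcw.volume_huge (by rw [hc])
    exact ⟨⟨hcw, hr ▸ hr'⟩, hσ⟩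
  | intoOpen c B B' σ hs hc ho hB =>
    rw [forall_mem_cons] at hσ ⊢
    have hb : P.b < c.cls := hc ▸ hs
    exact ⟨hB.wf hσ.1 (fun h => h.addOpen h0 h1 hc hb) (Container.volume_addOpen hb) (Or.inl rfl),
      hσ.2⟩
  | negFit c d σ hc hneg hd =>
    rw [forall_mem_cons] at hσ ⊢
    have hcw := Container.wf_of_opens h0 h1 hc
    obtain ⟨-, -, i, -, -, rfl⟩ := hc
    exact ⟨⟨hσ.1.1, hσ.1.2, hcw, hneg, by simp⟩, hσ.2⟩
  | negTemporary c d σ hc hneg hno hd hbest =>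
    rw [forall_mem_cons] at hσ ⊢
    have hcw := Container.wf_of_opens h0 h1 hc
    obtain ⟨-, -, i, -, -, rfl⟩ := hc
    obtain ⟨h2, hb, -⟩ := hσ.1.1.temporary hd.1
    exact ⟨⟨hσ.1.1.setStatus_temporary hd.1 (by simp),
      Container.half_lt_volume_of_type_two h2 hb rfl, hcw, hneg, by simp⟩, hσ.2⟩
  | negNew c σ hc hneg hno hno' =>
    rw [forall_mem_cons]
    have hcw := Container.wf_of_opens h0 h1 hc
    obtain ⟨-, -, i, -, -, rfl⟩ := hc
    exact ⟨⟨hcw, hneg, by simp⟩, hσ⟩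
  | posFit c d σ hc hpos ht hd =>
    rw [forall_mem_cons] at hσ ⊢
    exact ⟨⟨Container.wf_of_opens h0 h1 hc, hpos, hσ.1.1, hσ.1.2.1, ht⟩, hσ.2⟩
  | posTemporary c d σ hc hpos hno ht hd hbest =>
    rw [forall_mem_cons] at hσ ⊢
    have hj := hσ.1.1.joined
    have hv := hσ.1.2.1
    rw [← Container.joined_volume] at hv
    rw [Container.joined_of_temporary ht] at hj hv
    exact ⟨⟨Container.wf_of_opens h0 h1 hc, hpos, hj, hv, by simp⟩, hσ.2⟩
  | posNew c σ hc hpos hno =>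
    rw [forall_mem_cons]
    exact ⟨⟨Container.wf_of_opens h0 h1 hc, hpos⟩, hσ⟩
  | largeDeclared c B B' σ hs hc hdecl hB =>
    rw [forall_mem_cons] at hσ ⊢
    refine ⟨hB.wf hσ.1 (fun h => h.addSecond h0 h1 hc hdecl) ?_ (Or.inr rfl), hσ.2⟩
    rw [Container.volume_of_type_two rfl, Container.volume_of_type_two (by rw [hdecl]; rfl)]
  | largeOneFit j c d σ hj hn hc hd hbest =>
    rw [forall_mem_cons] at hσ ⊢
    subst hc
    have hw := Container.wf_large (st := .regular1) h0 h1 hj.1 hj.2.1 hj.2.2.1 (by simp)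
    exact ⟨⟨hσ.1.1, hσ.1.2, hw, (hw.volume_large_one hj.2.1 hj.2.2.1 rfl).2, by simp⟩, hσ.2⟩
  | largeOneNew j c σ hj hn hc hno =>
    rw [forall_mem_cons]
    subst hc
    have hw := Container.wf_large (st := .temporary1) h0 h1 hj.1 hj.2.1 hj.2.2.1 (by simp)
    exact ⟨⟨hw, (hw.volume_large_one hj.2.1 hj.2.2.1 rfl).2, by simp⟩, hσ⟩
  | largeTwoFit j c d σ hj hn hc hd =>
    rw [forall_mem_cons] at hσ ⊢
    subst hc
    have hw := Container.wf_large (st := .declared2) h0 h1 hj.1 hj.2.1 hj.2.2.1 (by simp)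
    refine ⟨⟨hw, Container.half_lt_volume_of_type_two hj.2.1 hj.2.2.1 rfl, hσ.1.1, hσ.1.2.1, ?_⟩,
      hσ.2⟩
    intro ht
    obtain ⟨h2, hb, -⟩ := hσ.1.1.temporary ht
    have h3 := (hσ.1.1.volume_large_one h2 hb (by rw [ht]; rfl)).1
    rw [Container.Fits, Container.volume_of_type_two rfl, P.A_two_large hj.2.2.1] at hd
    linarith [(P.t_large hj.2.1 hj.2.2.1).1]
  | largeTwoTemporary j c d σ hj hn hd ht hc hno hbest =>
    rw [forall_mem_cons] at hσ ⊢
    subst hc hd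
    exact ⟨⟨hσ.1.1.addTemporary h0 h1 hj.1 ht,
      Container.half_lt_volume_of_type_two hj.2.1 hj.2.2.1 rfl⟩, hσ.2⟩
  | largeTwoNew j c σ hj hn hc hno hno' =>
    rw [forall_mem_cons]
    subst hc
    have hw := Container.wf_large (st := .declared2) h0 h1 hj.1 hj.2.1 hj.2.2.1 (by simp)
    exact ⟨⟨hw, Container.half_lt_volume_of_type_two hj.2.1 hj.2.2.1 rfl⟩, hσ⟩

/-- Containers of different bins of a packing do not fit together if one of them is an unmatched
positive and the other one an unmatched negative container. -/
def NoFit (P : Params) (σ : Packing) : Prop :=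
  ∀ c d, Bin.positive c ∈ σ → Bin.negative d ∈ σ → ¬ c.Fits P d

theorem NoFit.mono {P : Params} {σ τ : Packing} (h : NoFit P τ) (hle : σ ≤ τ) : NoFit P σ :=
  fun c d hc hd => h c d (mem_of_le hle hc) (mem_of_le hle hd)

theorem noFit_neutral {P : Params} {σ : Packing} {c d : Container} :
    NoFit P (Bin.neutral c d ::ₘ σ) ↔ NoFit P σ := by
  simp [NoFit]

theorem noFit_positive {P : Params} {σ : Packing} {c : Container} :
    NoFit P (Bin.positive c ::ₘ σ) ↔
      (∀ d, Bin.negative d ∈ σ → ¬ c.Fits P d) ∧ NoFit P σ := by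
  simp only [NoFit, mem_cons, reduceCtorEq, false_or, Bin.positive.injEq]
  constructor
  · intro h
    exact ⟨fun d => h c d (Or.inl rfl), fun c' d hc => h c' d (Or.inr hc)⟩
  · rintro ⟨h1, h2⟩ c' d (rfl | hc) hd
    · exact h1 d hd
    · exact h2 c' d hc hd

theorem noFit_negative {P : Params} {σ : Packing} {d : Container} :
    NoFit P (Bin.negative d ::ₘ σ) ↔
      (∀ c, Bin.positive c ∈ σ → ¬ c.Fits P d) ∧ NoFit P σ := by
  simp only [NoFit, mem_cons, reduceCtorEq, false_or, Bin.negative.injEq]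
  constructor
  · intro h
    exact ⟨fun c hc => h c d hc (Or.inl rfl), fun c d' hc hd => h c d' hc (Or.inr hd)⟩
  · rintro ⟨h1, h2⟩ c d' hc (rfl | hd)
    · exact h1 c hc
    · exact h2 c d' hc hd

theorem Replace.noFit {P : Params} {c c' : Container} {B B' : Bin} {σ : Packing}
    (h : Replace c c' B B') (hv : c'.volume P = c.volume P) (hN : NoFit P (B ::ₘ σ)) :
    NoFit P (B' ::ₘ σ) := by
  cases h <;> simpa [noFit_positive, noFit_negative, noFit_neutral, Container.Fits, hv] using hN

theorem Step.noFit {P : Params} {s : ℝ} {σ σ' : Packing} (h : Step P s σ σ')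
    (hN : NoFit P σ) : NoFit P σ' := by
  cases h with
  | hugeNew c σ hs hc hno => exact noFit_positive.2 ⟨hno, hN⟩
  | intoOpen c B B' σ hs hc ho hB =>
    exact hB.noFit (Container.volume_addOpen (hc ▸ hs)) hN
  | negNew c σ hc hneg hno hno' => exact noFit_negative.2 ⟨hno, hN⟩
  | posNew c σ hc hpos hno => exact noFit_positive.2 ⟨hno, hN⟩
  | largeDeclared c B B' σ hs hc hdecl hB =>
    refine hB.noFit ?_ hN
    rw [Container.volume_of_type_two rfl, Container.volume_of_type_two (by rw [hdecl]; rfl)]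
  | largeOneNew j c σ hj hn hc hno => exact noFit_negative.2 ⟨hno, hN⟩
  | largeTwoTemporary j c d σ hj hn hd ht hc hno hbest =>
    exact noFit_positive.2 ⟨fun e he => hno e (mem_cons_of_mem he), hN.mono (le_cons_self _ _)⟩
  | largeTwoNew j c σ hj hn hc hno hno' => exact noFit_positive.2 ⟨hno, hN⟩
  | _ => exact noFit_neutral.2 (hN.mono (le_cons_self _ _))

/-- All items of a packing. -/
def Packing.items (σ : Packing) : Multiset ℝ := (Packing.containers σ).bind Container.items

theorem Packing.containers_cons (B : Bin) (σ : Packing) :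
    Packing.containers (B ::ₘ σ) = B.containers + Packing.containers σ := by
  simp [Packing.containers]

theorem Step.items {P : Params} {s : ℝ} {σ σ' : Packing} (h : Step P s σ σ') :
    Packing.items σ' = s ::ₘ Packing.items σ := by
  cases h with
  | intoOpen c B B' σ hs hc ho hB =>
    cases hB <;> simp [Packing.items, Packing.containers_cons, Bin.containers]
  | largeDeclared c B B' σ hs hc hdecl hB =>
    cases hB <;> simp [Packing.items, Packing.containers_cons, Bin.containers]
  | hugeFit c d σ hs hc hd hbest => subst hc; simp [Packing.items, Packing.containers_cons, Bin.containers]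
  | hugeNew c σ hs hc hno => subst hc; simp [Packing.items, Packing.containers_cons, Bin.containers]
  | negFit c d σ hc hneg hd =>
    obtain ⟨-, -, i, -, -, rfl⟩ := hc; simp [Packing.items, Packing.containers_cons, Bin.containers]
  | negTemporary c d σ hc hneg hno hd hbest =>
    obtain ⟨-, -, i, -, -, rfl⟩ := hc; simp [Packing.items, Packing.containers_cons, Bin.containers]
  | negNew c σ hc hneg hno hno' =>
    obtain ⟨-, -, i, -, -, rfl⟩ := hc; simp [Packing.items, Packing.containers_cons, Bin.containers]
  | posFit c d σ hc hpos ht hd =>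
    obtain ⟨-, -, i, -, -, rfl⟩ := hc; simp [Packing.items, Packing.containers_cons, Bin.containers]
  | posTemporary c d σ hc hpos hno ht hd hbest =>
    obtain ⟨-, -, i, -, -, rfl⟩ := hc; simp [Packing.items, Packing.containers_cons, Bin.containers]
  | posNew c σ hc hpos hno =>
    obtain ⟨-, -, i, -, -, rfl⟩ := hc; simp [Packing.items, Packing.containers_cons, Bin.containers]
  | largeOneFit j c d σ hj hn hc hd hbest => subst hc; simp [Packing.items, Packing.containers_cons, Bin.containers]
  | largeOneNew j c σ hj hn hc hno => subst hc; simp [Packing.items, Packing.containers_cons, Bin.containers]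
  | largeTwoFit j c d σ hj hn hc hd => subst hc; simp [Packing.items, Packing.containers_cons, Bin.containers]
  | largeTwoTemporary j c d σ hj hn hd ht hc hno hbest =>
    subst hc; simp [Packing.items, Packing.containers_cons, Bin.containers]
  | largeTwoNew j c σ hj hn hc hno hno' => subst hc; simp [Packing.items, Packing.containers_cons, Bin.containers]

theorem Run.wf {P : Params} {I : List ℝ} {σ : Packing} (h : Run P I σ)
    (hI : ∀ s ∈ I, 0 < s ∧ s ≤ 1) : ∀ B ∈ σ, B.WF P := by
  induction h with
  | nil => simp
  | snoc I s σ σ' _ hs ih =>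
    exact hs.wf (hI s (by simp)).1 (hI s (by simp)).2 (ih fun r hr => hI r (by simp [hr]))

theorem Run.noFit {P : Params} {I : List ℝ} {σ : Packing} (h : Run P I σ) : NoFit P σ := by
  induction h with
  | nil => simp [NoFit]
  | snoc I s σ σ' _ hs ih => exact hs.noFit ih

theorem Run.items {P : Params} {I : List ℝ} {σ : Packing} (h : Run P I σ) :
    Packing.items σ = I := by
  induction h with
  | nil => simp [Packing.items, Packing.containers]
  | snoc I s σ σ' _ hs ih =>
    rw [hs.items, ih, cons_coe, coe_eq_coe]
    exact List.perm_append_comm (l₁ := [s])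

open scoped Classical in
/-- The indicator of a proposition. -/
noncomputable def ind (p : Prop) : ℕ := if p then 1 else 0

theorem ind_of_true {p : Prop} (h : p) : ind p = 1 := if_pos h

theorem ind_of_false {p : Prop} (h : ¬ p) : ind p = 0 := if_neg h

theorem ind_le_one (p : Prop) : ind p ≤ 1 := by
  unfold ind; split_ifs <;> simp

theorem ind_mono {p q : Prop} (h : p → q) : ind p ≤ ind q := by
  by_cases hp : p
  · rw [ind_of_true (h hp)]; exact ind_le_one p
  · rw [ind_of_false hp]; exact Nat.zero_le _

open scoped Classical in
/-- The number of containers with a given property. -/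
noncomputable def Packing.count (p : Container → Prop) (σ : Packing) : ℕ :=
  (Packing.containers σ).countP p

theorem Packing.num_eq_count (σ : Packing) (j : ℕ) :
    Packing.num σ j = Packing.count (fun c => c.cls = j) σ := by
  rw [Packing.num, Packing.count]; congr

theorem Packing.numType_eq_count (σ : Packing) (i j : ℕ) :
    Packing.numType σ i j = Packing.count (fun c => c.cls = j ∧ c.status.type = i) σ := by
  rw [Packing.numType, Packing.count]; congr

/-- The number of open containers of class `j`. -/
noncomputable def Packing.numOpen (P : Params) (σ : Packing) (j : ℕ) : ℕ :=
  Packing.count (fun c => c.cls = j ∧ c.IsOpen P) σ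

/-- The number of declared type 2 containers of class `j`. -/
noncomputable def Packing.numDeclared (σ : Packing) (j : ℕ) : ℕ :=
  Packing.count (fun c => c.cls = j ∧ c.status = .declared2) σ

/-- A bin that contains only a temporary type 1 container of class `k` whose item has size
greater than `β`. -/
def Bin.IsBigTemporary (β : ℝ) (k : ℕ) : Bin → Prop
  | .negative d => d.cls = k ∧ d.status = .temporary1 ∧ β < d.items.sum
  | _ => False

/-- A bin that contains only a positive container of class `k` all of whose items have size
at most `β`. -/
def Bin.IsLight (β : ℝ) (k : ℕ) : Bin → Prop
  | .positive c => c.cls = k ∧ ∀ s ∈ c.items, s ≤ β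
  | _ => False

open scoped Classical in
/-- The number of bins with a given property. -/
noncomputable def Packing.binCount (p : Bin → Prop) (σ : Packing) : ℕ := countP p σ

section Counting

variable (p : Container → Prop) (q : Bin → Prop) (B : Bin) (c d : Container) (σ : Packing)

theorem Packing.count_zero : Packing.count p 0 = 0 := by
  simp [Packing.count, Packing.containers]

theorem Packing.count_positive :
    Packing.count p (Bin.positive c ::ₘ σ) = Packing.count p σ + ind (p c) := by
  rw [Packing.count, Packing.containers_cons, Bin.containers, singleton_add, countP_cons]; rfl

theorem Packing.count_negative :
    Packing.count p (Bin.negative d ::ₘ σ) = Packing.count p σ + ind (p d) := by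
  rw [Packing.count, Packing.containers_cons, Bin.containers, singleton_add, countP_cons]; rfl

theorem Packing.count_neutral :
    Packing.count p (Bin.neutral c d ::ₘ σ) = Packing.count p σ + ind (p c) + ind (p d) := by
  rw [Packing.count, Packing.containers_cons, Bin.containers, insert_eq_cons, cons_add,
    singleton_add, countP_cons, countP_cons, add_right_comm]; rfl

theorem Packing.count_eq_zero {p : Container → Prop} {σ : Packing} :
    Packing.count p σ = 0 ↔ ∀ c ∈ Packing.containers σ, ¬ p c := by
  classical
  unfold Packing.count; exact Multiset.countP_eq_zero

theorem Packing.binCount_cons :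
    Packing.binCount q (B ::ₘ σ) = Packing.binCount q σ + ind (q B) := by
  rw [Packing.binCount, countP_cons]; rfl

theorem Packing.binCount_eq_zero {q : Bin → Prop} {σ : Packing} :
    Packing.binCount q σ = 0 ↔ ∀ B ∈ σ, ¬ q B := by
  classical
  unfold Packing.binCount; exact Multiset.countP_eq_zero

end Counting

theorem Replace.count_eq {c c' : Container} {B B' : Bin} (h : Replace c c' B B') (σ : Packing)
    (p : Container → Prop) :
    Packing.count p (B' ::ₘ σ) + ind (p c) = Packing.count p (B ::ₘ σ) + ind (p c') := by
  cases h <;> simp only [Packing.count_positive, Packing.count_negative, Packing.count_neutral] <;>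
    omega

/-- The effect of packing an item on the numbers of containers of a small class or the tiny
class `j`. -/
def SmallEffect (P : Params) (j : ℕ) (σ σ' : Packing) : Prop :=
  (Packing.numOpen P σ' j ≤ Packing.numOpen P σ j ∧
    (∀ i, Packing.numType σ' i j = Packing.numType σ i j) ∧
    Packing.num σ' j = Packing.num σ j) ∨
  (Packing.numOpen P σ j = 0 ∧ Packing.numOpen P σ' j ≤ 1 ∧
    ∃ i₀, Eligible P σ j i₀ ∧
      (∀ i, Packing.numType σ' i j = Packing.numType σ i j + if i = i₀ then 1 else 0) ∧
      Packing.num σ' j = Packing.num σ j + 1)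

theorem Opens.smallEffect {P : Params} {s : ℝ} {c : Container} {σ σ' : Packing} {j : ℕ}
    (h : Opens P s σ c)
    (hp : ∀ p : Container → Prop, (∀ c, p c → c.cls = j) →
      Packing.count p σ' = Packing.count p σ + ind (p c)) :
    SmallEffect P j σ σ' := by
  obtain ⟨hb, hno, i₀, hi₀, -, rfl⟩ := h
  have h1 := hp (fun c => c.cls = j ∧ c.IsOpen P) (fun c hc => hc.1)
  have h2 := fun i => hp (fun c => c.cls = j ∧ c.status.type = i) (fun c hc => hc.1)
  have h3 := hp (fun c => c.cls = j) (fun c hc => hc)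
  simp only [SmallEffect, Packing.numType_eq_count, Packing.num_eq_count, Packing.numOpen]
  simp only [h1, h2, h3]
  by_cases hj : P.classOf s = j
  · right
    have h0 : Packing.count (fun c : Container => c.cls = j ∧ c.IsOpen P) σ = 0 := by
      rw [Packing.count_eq_zero]
      rintro d hd ⟨hdj, hdo⟩
      exact hno d hd (hdj.trans hj.symm) hdo
    refine ⟨h0, ?_, i₀, hj ▸ hi₀, fun i => ?_, ?_⟩
    · rw [h0, zero_add]; exact ind_le_one _
    · simp [ind, hj, Status.type, eq_comm (a := i)]
    · simp [ind, hj]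
  · left
    simp [ind, hj]

theorem smallEffect_of_count {P : Params} {σ σ' : Packing} {j : ℕ}
    (hp : ∀ p : Container → Prop, (∀ c, p c → c.cls = j) →
      Packing.count p σ' = Packing.count p σ) :
    SmallEffect P j σ σ' := by
  refine Or.inl ⟨?_, fun i => ?_, ?_⟩
  · exact (hp (fun c => c.cls = j ∧ c.IsOpen P) (fun c hc => hc.1)).le
  · rw [Packing.numType_eq_count, Packing.numType_eq_count, hp _ (fun c hc => hc.1)]
  · rw [Packing.num_eq_count, Packing.num_eq_count, hp _ (fun c hc => hc)]

theorem Step.smallEffect {P : Params} {s : ℝ} {σ σ' : Packing} {j : ℕ} (hj : P.b < j)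
    (h : Step P s σ σ') (hσ : ∀ B ∈ σ, B.WF P) : SmallEffect P j σ σ' := by
  have hb2 := P.two_le_b
  have key : ∀ (p : Container → Prop), (∀ c, p c → c.cls = j) → ∀ c : Container, c.cls ≤ P.b →
      ind (p c) = 0 := fun p hp c hc => ind_of_false fun h => by have := hp c h; omega
  cases h with
  | hugeFit c d σ hs hc hd hbest =>
    refine smallEffect_of_count fun p hp => ?_
    rw [Packing.count_neutral, Packing.count_negative, key p hp c (by rw [hc]; simp; omega)]
    by_cases ht : d.status = .temporary1
    · have hd := ((hσ _ (mem_cons_self _ _)).1.temporary ht).2.1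
      rw [key p hp d hd, key p hp d.joined (by simpa using hd)]
    · rw [Container.joined_of_ne ht, add_zero]
  | hugeNew c σ hs hc hno =>
    refine smallEffect_of_count fun p hp => ?_
    rw [Packing.count_positive, key p hp c (by rw [hc]; simp; omega), add_zero]
  | intoOpen c B B' σ hs hc ho hB =>
    have hcc := hB.count_eq σ
    refine Or.inl ⟨?_, fun i => ?_, ?_⟩
    · have h1 := hcc (fun c => c.cls = j ∧ c.IsOpen P)
      have h2 : ind (c.cls = j ∧ Container.IsOpen P { c with items := s ::ₘ c.items }) ≤
        ind (c.cls = j ∧ c.IsOpen P) := ind_mono fun h => ⟨h.1, ho⟩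
      rw [Packing.numOpen, Packing.numOpen]
      simp only at h1
      omega
    · rw [Packing.numType_eq_count, Packing.numType_eq_count]
      have := hcc (fun c => c.cls = j ∧ c.status.type = i)
      simpa only [add_left_inj] using this
    · have := hcc (fun c => c.cls = j)
      rw [Packing.num_eq_count, Packing.num_eq_count]
      simpa only [add_left_inj] using this
  | negFit c d σ hc hneg hd =>
    exact hc.smallEffect fun p _ => by simp only [Packing.count_neutral, Packing.count_positive]
  | negTemporary c d σ hc hneg hno hd hbest =>
    have hd := ((hσ _ (mem_cons_self _ _)).1.temporary hd.1).2.1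
    refine hc.smallEffect fun p hp => ?_
    rw [Packing.count_neutral, Packing.count_negative, key p hp d hd, key p hp _ (by simpa using hd)]
  | negNew c σ hc hneg hno hno' =>
    exact hc.smallEffect fun p _ => Packing.count_negative _ _ _
  | posFit c d σ hc hpos ht hd =>
    exact hc.smallEffect fun p _ => by
      rw [Packing.count_neutral, Packing.count_negative]; omega
  | posTemporary c d σ hc hpos hno ht hd hbest =>
    have hd := ((hσ _ (mem_cons_self _ _)).1.temporary ht).2.1
    refine hc.smallEffect fun p hp => ?_
    rw [Packing.count_neutral, Packing.count_negative, key p hp d hd,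
      key p hp { d with status := .regular1 } (by simpa using hd)]
    omega
  | posNew c σ hc hpos hno =>
    exact hc.smallEffect fun p _ => Packing.count_positive _ _ _
  | largeDeclared c B B' σ hs hc hdecl hB =>
    refine smallEffect_of_count fun p hp => ?_
    have := hB.count_eq σ p
    rw [key p hp c (by omega), key p hp _ (by simp; omega)] at this
    exact this
  | largeOneFit i c d σ hi hn hc hd hbest =>
    refine smallEffect_of_count fun p hp => ?_
    rw [Packing.count_neutral, Packing.count_positive, key p hp c (by rw [hc]; exact hi.2.2.1)]
    rfl
  | largeOneNew i c σ hi hn hc hno =>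
    refine smallEffect_of_count fun p hp => ?_
    rw [Packing.count_negative, key p hp c (by rw [hc]; exact hi.2.2.1)]
    rfl
  | largeTwoFit i c d σ hi hn hc hd =>
    refine smallEffect_of_count fun p hp => ?_
    rw [Packing.count_neutral, Packing.count_negative, key p hp c (by rw [hc]; exact hi.2.2.1)]
    rfl
  | largeTwoTemporary i c d σ hi hn hd ht hc hno hbest =>
    refine smallEffect_of_count fun p hp => ?_
    rw [Packing.count_positive, Packing.count_negative, key p hp c (by rw [hc]; exact hi.2.2.1),
      key p hp d (by rw [hd]; exact hi.2.2.1)]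
  | largeTwoNew i c σ hi hn hc hno hno' =>
    refine smallEffect_of_count fun p hp => ?_
    rw [Packing.count_positive, key p hp c (by rw [hc]; exact hi.2.2.1)]
    rfl

theorem Run.small {P : Params} {I : List ℝ} {σ : Packing} {j : ℕ} (hj : P.b < j)
    (hjM : j ≤ P.M + 1) (h : Run P I σ) (hI : ∀ s ∈ I, 0 < s ∧ s ≤ 1) :
    Packing.numOpen P σ j ≤ 1 ∧
      ∀ i ∈ Finset.Icc 1 (P.γ j), (Packing.numType σ i j : ℝ) ≤ P.α i j * Packing.num σ j + 1 := by
  have hb2 := P.two_le_b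
  induction h with
  | nil => simp [Packing.numOpen, Packing.numType, Packing.num, Packing.count, Packing.containers]
  | snoc I s σ σ' hI' hs ih =>
    have hI'' : ∀ s ∈ I, 0 < s ∧ s ≤ 1 := fun r hr => hI r (by simp [hr])
    obtain ⟨ih1, ih2⟩ := ih hI''
    rcases hs.smallEffect hj (hI'.wf hI'') with ⟨h1, h2, h3⟩ | ⟨-, h1, i₀, hi₀, h2, h3⟩
    · refine ⟨h1.trans ih1, fun i hi => ?_⟩
      rw [h2, h3]
      exact ih2 i hi
    · refine ⟨h1, fun i hi => ?_⟩
      have hα := P.alpha_nonneg (by omega) hjM hi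
      have := ih2 i hi
      rw [h2, h3]
      split_ifs with hii
      · subst hii
        have hfl := hi₀.2.2.2
        have : (Packing.numType σ i j : ℝ) ≤ P.α i j * Packing.num σ j :=
          (Nat.cast_le.2 hfl).trans (Nat.floor_le (by positivity))
        push_cast
        linarith
      · push_cast
        linarith

/-- The numbers of type 1, type 2 and declared containers of a large class, of temporary type 1
containers with an item of size greater than `β`, and of unmatched positive containers all of whose
items have size at most `β`. -/
structure LargeStats where
  one : ℕ
  two : ℕ
  declared : ℕ
  bigTemp : ℕ
  light : ℕ

noncomputable def Packing.largeStats (β : ℝ) (k : ℕ) (σ : Packing) : LargeStats where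
  one := Packing.count (fun c => c.cls = k ∧ c.status.type = 1) σ
  two := Packing.count (fun c => c.cls = k ∧ c.status.type = 2) σ
  declared := Packing.numDeclared σ k
  bigTemp := Packing.binCount (Bin.IsBigTemporary β k) σ
  light := Packing.binCount (Bin.IsLight β k) σ

/-- The bound on the number of type 2 containers. -/
noncomputable def LargeStats.bound (α : ℝ) (x : LargeStats) : ℕ := ⌊α * ((x.one + x.two : ℕ) : ℝ)⌋₊

/-- The possible effects of packing an item on the numbers of containers of a large class. -/
inductive LargeEffect (α : ℝ) (x y : LargeStats) : Prop
  | keep (h1 : y.one = x.one) (h2 : y.two = x.two) (h3 : y.declared ≤ x.declared)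
      (h4 : y.bigTemp ≤ x.bigTemp) (h5 : y.light ≤ x.light)
  | addOne (h0 : x.declared = 0) (hb : x.two = x.bound α) (h1 : y.one = x.one + 1)
      (h2 : y.two = x.two) (h3 : y.declared = 0) (h4 : y.bigTemp ≤ x.bigTemp + 1)
      (h5 : y.light ≤ x.light)
  | addTwo (h0 : x.declared = 0) (hb : x.two < x.bound α) (h1 : y.one = x.one)
      (h2 : y.two = x.two + 1) (h3 : y.declared ≤ 1) (h4 : y.bigTemp ≤ x.bigTemp)
      (h5 : y.light ≤ x.light + 1) (h6 : y.light ≤ x.light ∨ x.bigTemp = 0)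
  | convert (hb : x.two < x.bound α) (h1 : x.one = y.one + 1)
      (h2 : y.two = x.two + 1) (h3 : y.declared ≤ x.declared + 1)
      (h5 : y.light ≤ x.light + 1)
      (h6 : y.bigTemp + 1 ≤ x.bigTemp ∧ y.light ≤ x.light ∨ y.bigTemp = 0)

/-- The invariant for the numbers of containers of a large class.  The last component refers to the
numbers `m₁` and `m₂` of type 1 and type 2 containers at the last time when there was no temporary
type 1 container with an item of size greater than `β`. -/
structure LargeStats.Inv (α : ℝ) (x : LargeStats) : Prop where
  two_le : x.two ≤ x.bound α
  le_two : x.bound α ≤ x.two + 1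
  declared_le : x.declared + x.bound α ≤ x.two + 2
  light_le : x.light ≤ x.two
  base : ∃ m₁ m₂ : ℕ, m₂ ≤ ⌊α * ((m₁ + m₂ : ℕ) : ℝ)⌋₊ ∧ ⌊α * ((m₁ + m₂ : ℕ) : ℝ)⌋₊ ≤ m₂ + 1 ∧
    m₁ + x.bigTemp ≤ x.one ∧ x.light ≤ m₂ ∧ m₂ ≤ x.two

theorem LargeEffect.inv {α : ℝ} (h0 : 0 ≤ α) (h1 : α ≤ 1) {x y : LargeStats}
    (h : LargeEffect α x y) (hx : x.Inv α) : y.Inv α := by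
  have mono : ∀ m n : ℕ, m ≤ n → ⌊α * (m : ℝ)⌋₊ ≤ ⌊α * (n : ℝ)⌋₊ := fun m n hmn =>
    Nat.floor_mono (mul_le_mul_of_nonneg_left (Nat.cast_le.2 hmn) h0)
  have succ : ∀ n : ℕ, ⌊α * ((n + 1 : ℕ) : ℝ)⌋₊ ≤ ⌊α * (n : ℝ)⌋₊ + 1 := by
    intro n
    rw [← Nat.floor_add_one (by positivity)]
    refine Nat.floor_mono ?_
    push_cast
    linarith
  obtain ⟨a1, a2, a3, a4, m₁, m₂, b1, b2, b3, b4, b5⟩ := hx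
  have pre : y.two ≤ y.bound α ∧ y.bound α ≤ y.two + 1 ∧ y.declared + y.bound α ≤ y.two + 2 ∧
      y.light ≤ y.two := by
    simp only [LargeStats.bound] at *
    cases h with
    | keep h1 h2 h3 h4 h5 => rw [h1, h2]; omega
    | addOne h0 hb h1 h2 h3 h4 h5 =>
      simp only [LargeStats.bound] at hb
      rw [h1, h2, add_right_comm]
      have := succ (x.one + x.two)
      have := mono (x.one + x.two) (x.one + x.two + 1) (by omega)
      omega
    | addTwo h0 hb h1 h2 h3 h4 h5 h6 =>
      simp only [LargeStats.bound] at hb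
      rw [h1, h2, ← add_assoc]
      have := succ (x.one + x.two)
      have := mono (x.one + x.two) (x.one + x.two + 1) (by omega)
      omega
    | convert hb h1 h2 h3 h5 h6 =>
      simp only [LargeStats.bound] at hb
      have : y.one + y.two = x.one + x.two := by omega
      rw [this, h2]
      omega
  refine ⟨pre.1, pre.2.1, pre.2.2.1, pre.2.2.2, ?_⟩
  by_cases hq : y.bigTemp = 0
  · exact ⟨y.one, y.two, pre.1, pre.2.1, by omega, pre.2.2.2, le_rfl⟩
  · refine ⟨m₁, m₂, b1, b2, ?_⟩
    cases h <;> omega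

section Large

variable {P : Params} {s β : ℝ} {k : ℕ} {σ σ' : Packing}

theorem num_eq_one_add_two (σ : Packing) (hσ : ∀ B ∈ σ, B.WF P) (h2 : 2 ≤ k)
    (hk : k ≤ P.b) : Packing.num σ k = (Packing.largeStats β k σ).one +
      (Packing.largeStats β k σ).two := by
  rw [Packing.num_eq_count, Packing.largeStats]
  have key : ∀ c : Container, c.WF P → ind (c.cls = k) =
      ind (c.cls = k ∧ c.status.type = 1) + ind (c.cls = k ∧ c.status.type = 2) := by
    intro c hc
    by_cases hck : c.cls = k
    · rcases hc.type_large (hck ▸ h2) (hck ▸ hk) with h | h <;> simp [ind, hck, h]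
    · simp [ind, hck]
  induction σ using Multiset.induction_on with
  | empty => simp [Packing.count_zero]
  | cons B σ ih =>
    rw [forall_mem_cons] at hσ
    have ih := ih hσ.2
    have hB := hσ.1
    simp only at ih
    cases B with
    | positive c => simp only [Packing.count_positive]; have := key c hB.1; omega
    | negative c => simp only [Packing.count_negative]; have := key c hB.1; omega
    | neutral c d =>
      simp only [Packing.count_neutral]; have := key c hB.1; have := key d hB.2.2.1; omega

theorem type2Bound_eq (hσ : ∀ B ∈ σ, B.WF P) (h2 : 2 ≤ k) (hk : k ≤ P.b) :
    type2Bound P σ k = (Packing.largeStats β k σ).bound (P.α 2 k) := by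
  rw [type2Bound, LargeStats.bound, num_eq_one_add_two σ hσ h2 hk]

theorem numType_two_eq : Packing.numType σ 2 k = (Packing.largeStats β k σ).two :=
  Packing.numType_eq_count _ _ _

theorem Replace.isBigTemporary {c c' : Container} {B B' : Bin} (h : Replace c c' B B')
    (hc : c'.cls = k → c'.status ≠ .temporary1) :
    B'.IsBigTemporary β k → B.IsBigTemporary β k := by
  cases h <;> simp [Bin.IsBigTemporary]
  intro h1 h2
  exact absurd h2 (hc h1)

theorem Replace.isLight {c c' : Container} {B B' : Bin} (h : Replace c c' B B')
    (hc : c'.cls = c.cls) (hi : c.cls = k → c.items ≤ c'.items) :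
    B'.IsLight β k → B.IsLight β k := by
  cases h <;> simp [Bin.IsLight]
  intro h1 h2
  exact ⟨hc ▸ h1, fun s hs => h2 s (mem_of_le (hi (hc ▸ h1)) hs)⟩

theorem bigTemp_eq_zero {v : ℝ} (hv : v ≤ β)
    (h : ∀ d, Bin.negative d ∈ σ → d.cls = k → d.status = .temporary1 → d.items.sum ≤ v) :
    Packing.binCount (Bin.IsBigTemporary β k) σ = 0 := by
  rw [Packing.binCount_eq_zero]
  intro B hB hBt
  cases B with
  | negative d => exact absurd (h d hB hBt.1 hBt.2.1) (not_le.2 (hv.trans_lt hBt.2.2))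
  | _ => exact hBt

theorem Opens.cls_ne {c : Container} (h : Opens P s σ c) (hk : k ≤ P.b) : c.cls ≠ k := by
  obtain ⟨hb, -, i, -, -, rfl⟩ := h
  simp only
  omega

theorem LargeNoDeclared.numDeclared_eq_zero (h : LargeNoDeclared P s σ k) :
    Packing.numDeclared σ k = 0 := by
  rw [Packing.numDeclared, Packing.count_eq_zero]
  rintro c hc ⟨h1, h2⟩
  exact h.2.2.2 c hc h1 h2

theorem Step.largeEffect (hk2 : 2 ≤ k) (hk : k ≤ P.b)
    (h : Step P s σ σ') (hσ : ∀ B ∈ σ, B.WF P) :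
    LargeEffect (P.α 2 k) (Packing.largeStats β k σ) (Packing.largeStats β k σ') := by
  have hbd := type2Bound_eq (β := β) hσ hk2 hk
  have hn2 := numType_two_eq (β := β) (k := k) (σ := σ)
  cases h with
  | hugeFit c d σ hs hc hd hbest =>
    have hck : c.cls ≠ k := by rw [hc]; simp; omega
    apply LargeEffect.keep <;>
      simp [Packing.largeStats, Packing.numDeclared, Packing.count_neutral, Packing.count_negative,
        Packing.binCount_cons, Bin.IsBigTemporary, Bin.IsLight, hck, ind_of_false,
        Container.joined_declared]
  | hugeNew c σ hs hc hno =>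
    have hck : c.cls ≠ k := by rw [hc]; simp; omega
    apply LargeEffect.keep <;>
      simp [Packing.largeStats, Packing.numDeclared, Packing.count_positive,
        Packing.binCount_cons, Bin.IsBigTemporary, Bin.IsLight, hck, ind_of_false]
  | intoOpen c B B' σ hs hc ho hB =>
    have hck : c.cls ≠ k := by omega
    have key := fun p : Container → Prop => hB.count_eq σ (fun c => c.cls = k ∧ p c)
    simp only [hck, false_and, add_left_inj] at key
    apply LargeEffect.keep
    · exact key _
    · exact key _
    · exact (key _).le
    · simp only [Packing.largeStats, Packing.binCount_cons]
      exact Nat.add_le_add_left (ind_mono (hB.isBigTemporary fun h => absurd h hck)) _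
    · simp only [Packing.largeStats, Packing.binCount_cons]
      exact Nat.add_le_add_left (ind_mono (hB.isLight rfl fun h => absurd h hck)) _
  | negFit c d σ hc hneg hd =>
    have hck := hc.cls_ne hk
    apply LargeEffect.keep <;>
      simp [Packing.largeStats, Packing.numDeclared, Packing.count_neutral, Packing.count_positive,
        Packing.binCount_cons, Bin.IsBigTemporary, Bin.IsLight, hck, ind_of_false]
  | negTemporary c d σ hc hneg hno hd hbest =>
    have hck := hc.cls_ne hk
    obtain ⟨hdt, hd1, hd2⟩ := hd
    by_cases hdk : d.cls = k
    · have hdv := Container.volume_of_type_one (P := P) (c := d) (by rw [hdt]; rfl) (by omega)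
      apply LargeEffect.convert
      · rw [← hbd, ← hn2]
        rw [hdk] at hd2
        omega
      · simp [Packing.largeStats, Packing.count_neutral, Packing.count_negative, hck, hdk, hdt,
          Status.type, ind]
      · simp [Packing.largeStats, Packing.count_neutral, Packing.count_negative, hck, hdk, hdt,
          Status.type, ind]
      · simp [Packing.largeStats, Packing.numDeclared, Packing.count_neutral,
          Packing.count_negative, hck, hdk, hdt, ind]
      · simp [Packing.largeStats, Packing.binCount_cons, Bin.IsLight, ind]
      · by_cases hβ : β < d.items.sum
        · left
          simp [Packing.largeStats, Packing.binCount_cons, Bin.IsLight, Bin.IsBigTemporary, ind,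
            hdk, hdt, hβ]
        · right
          have hz : Packing.binCount (Bin.IsBigTemporary β k) σ = 0 := by
            refine bigTemp_eq_zero (not_lt.1 hβ) fun e he hek het => ?_
            have := hbest e he het (hek.trans hdk.symm)
            rwa [hdv, Container.volume_of_type_one (by rw [het]; rfl) (by omega)] at this
          simp [Packing.largeStats, Packing.binCount_cons, hz, ind, Bin.IsBigTemporary]
    · apply LargeEffect.keep <;>
        simp [Packing.largeStats, Packing.numDeclared, Packing.count_neutral,
          Packing.count_negative, Packing.binCount_cons, Bin.IsBigTemporary, Bin.IsLight, hck, hdk,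
          ind_of_false]
  | negNew c σ hc hneg hno hno' =>
    have hck := hc.cls_ne hk
    apply LargeEffect.keep <;>
      simp [Packing.largeStats, Packing.numDeclared, Packing.count_negative,
        Packing.binCount_cons, Bin.IsBigTemporary, Bin.IsLight, hck, ind_of_false]
  | posFit c d σ hc hpos ht hd =>
    have hck := hc.cls_ne hk
    apply LargeEffect.keep <;>
      simp [Packing.largeStats, Packing.numDeclared, Packing.count_neutral, Packing.count_negative,
        Packing.binCount_cons, Bin.IsBigTemporary, Bin.IsLight, hck, ind_of_false]
  | posTemporary c d σ hc hpos hno ht hd hbest =>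
    have hck := hc.cls_ne hk
    apply LargeEffect.keep <;>
      simp [Packing.largeStats, Packing.numDeclared, Packing.count_neutral, Packing.count_negative,
        Packing.binCount_cons, Bin.IsBigTemporary, Bin.IsLight, hck, ind_of_false, ht, Status.type]
  | posNew c σ hc hpos hno =>
    have hck := hc.cls_ne hk
    apply LargeEffect.keep <;>
      simp [Packing.largeStats, Packing.numDeclared, Packing.count_positive,
        Packing.binCount_cons, Bin.IsBigTemporary, Bin.IsLight, hck, ind_of_false]
  | largeDeclared c B B' σ hs hc hdecl hB =>
    have key := fun p => hB.count_eq σ p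
    apply LargeEffect.keep
    · have := key (fun c => c.cls = k ∧ c.status.type = 1)
      simp only [hdecl, show Status.declared2.type = 2 from rfl,
        show Status.regular2.type = 2 from rfl, add_left_inj] at this
      exact this
    · have := key (fun c => c.cls = k ∧ c.status.type = 2)
      simp only [hdecl, show Status.declared2.type = 2 from rfl,
        show Status.regular2.type = 2 from rfl, add_left_inj] at this
      exact this
    · have := key (fun c => c.cls = k ∧ c.status = .declared2)
      simp only [reduceCtorEq, and_false, ind_of_false, not_false_eq_true] at this
      simp only [Packing.largeStats, Packing.numDeclared]
      omega
    · simp only [Packing.largeStats, Packing.binCount_cons]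
      exact Nat.add_le_add_left (ind_mono (hB.isBigTemporary fun _ => by simp)) _
    · simp only [Packing.largeStats, Packing.binCount_cons]
      exact Nat.add_le_add_left (ind_mono (hB.isLight rfl fun _ => le_cons_self _ _)) _
  | largeOneFit j c d σ hj hn hc hd hbest =>
    by_cases hjk : j = k
    · subst hjk
      have hz := hj.numDeclared_eq_zero
      apply LargeEffect.addOne hz (by rw [← hbd, ← hn2, hn]) <;>
        simp [Packing.largeStats, Packing.numDeclared, Packing.count_neutral,
          Packing.count_positive, Packing.binCount_cons, Bin.IsBigTemporary, Bin.IsLight, hc,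
          Status.type, ind] at hz ⊢
      omega
    · apply LargeEffect.keep <;>
        simp [Packing.largeStats, Packing.numDeclared, Packing.count_neutral,
          Packing.count_positive, Packing.binCount_cons, Bin.IsBigTemporary, Bin.IsLight, hc, hjk,
          ind_of_false]
  | largeOneNew j c σ hj hn hc hno =>
    by_cases hjk : j = k
    · subst hjk
      have hz := hj.numDeclared_eq_zero
      apply LargeEffect.addOne hz (by rw [← hbd, ← hn2, hn]) <;>
        simp [Packing.largeStats, Packing.numDeclared, Packing.count_negative,
          Packing.binCount_cons, Bin.IsBigTemporary, Bin.IsLight, hc,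
          Status.type, ind] at hz ⊢ <;> first | omega | (split_ifs <;> omega)
    · apply LargeEffect.keep <;>
        simp [Packing.largeStats, Packing.numDeclared, Packing.count_negative,
          Packing.binCount_cons, Bin.IsBigTemporary, Bin.IsLight, hc, hjk,
          ind_of_false]
  | largeTwoFit j c d σ hj hn hc hd =>
    by_cases hjk : j = k
    · subst hjk
      have hz := hj.numDeclared_eq_zero
      have h1 : ind (c.cls = j ∧ c.status.type = 1) = 0 := by simp [hc, Status.type, ind]
      have h2 : ind (c.cls = j ∧ c.status.type = 2) = 1 := by simp [hc, Status.type, ind]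
      have h3 := ind_le_one (c.cls = j ∧ c.status = .declared2)
      apply LargeEffect.addTwo hz (by rw [← hbd, ← hn2]; exact hn) <;>
        simp only [Packing.largeStats, Packing.numDeclared, Packing.count_neutral,
          Packing.count_negative, Packing.binCount_cons, Bin.IsBigTemporary, Bin.IsLight,
          ind_of_false (p := False) id] at hz ⊢ <;> omega
    · apply LargeEffect.keep <;>
        simp [Packing.largeStats, Packing.numDeclared, Packing.count_neutral,
          Packing.count_negative, Packing.binCount_cons, Bin.IsBigTemporary, Bin.IsLight, hc, hjk,
          ind_of_false]
  | largeTwoTemporary j c d σ hj hn hd ht hc hno hbest =>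
    by_cases hjk : j = k
    · subst hjk
      have hdv := Container.volume_of_type_one (P := P) (c := d) (by rw [ht]; rfl) (by omega)
      have hwf := (hσ _ (mem_cons_self _ _)).1
      obtain ⟨r, hr, -⟩ := hwf.exists_item (by omega) (by rw [ht]; rfl)
      apply LargeEffect.convert
      · rw [← hbd, ← hn2]; exact hn
      · simp [Packing.largeStats, Packing.count_positive, Packing.count_negative, hc, hd, ht,
          Status.type, ind]
      · simp [Packing.largeStats, Packing.count_positive, Packing.count_negative, hc, hd, ht,
          Status.type, ind]
      · simp [Packing.largeStats, Packing.numDeclared, Packing.count_positive,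
          Packing.count_negative, hc, ht, ind]
      · simp only [Packing.largeStats, Packing.binCount_cons, Bin.IsLight]
        have := ind_le_one (c.cls = j ∧ ∀ s ∈ c.items, s ≤ β)
        omega
      · by_cases hβ : β < d.items.sum
        · left
          have hrβ : β < r := by rwa [hr, sum_singleton] at hβ
          simp [Packing.largeStats, Packing.binCount_cons, Bin.IsLight, Bin.IsBigTemporary, ind,
            hd, ht, hc, hr, hrβ]
        · right
          have hz : Packing.binCount (Bin.IsBigTemporary β j) σ = 0 := by
            refine bigTemp_eq_zero (not_lt.1 hβ) fun e he hek het => ?_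
            have := hbest e he het hek
            rwa [hdv, Container.volume_of_type_one (by rw [het]; rfl) (by omega)] at this
          simp [Packing.largeStats, Packing.binCount_cons, hz, ind, Bin.IsBigTemporary]
    · apply LargeEffect.keep <;>
        simp [Packing.largeStats, Packing.numDeclared, Packing.count_positive,
          Packing.count_negative, Packing.binCount_cons, Bin.IsBigTemporary, Bin.IsLight, hc, hd,
          hjk, ind_of_false]
  | largeTwoNew j c σ hj hn hc hno hno' =>
    by_cases hjk : j = k
    · subst hjk
      have hz := hj.numDeclared_eq_zero
      have hq : Packing.binCount (Bin.IsBigTemporary β j) σ = 0 :=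
        bigTemp_eq_zero le_rfl fun e he hek het => absurd het (hno' e he hek)
      apply LargeEffect.addTwo hz (by rw [← hbd, ← hn2]; exact hn)
      · simp [Packing.largeStats, Packing.count_positive, hc, Status.type, ind]
      · simp [Packing.largeStats, Packing.count_positive, hc, Status.type, ind]
      · simp only [Packing.largeStats, Packing.numDeclared, Packing.count_positive] at hz ⊢
        rw [hz, zero_add]
        exact ind_le_one _
      · simp [Packing.largeStats, Packing.binCount_cons, Bin.IsBigTemporary, ind]
      · simp only [Packing.largeStats, Packing.binCount_cons]
        exact Nat.add_le_add_left (ind_le_one _) _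
      · exact Or.inr hq
    · apply LargeEffect.keep <;>
        simp [Packing.largeStats, Packing.numDeclared, Packing.count_positive,
          Packing.binCount_cons, Bin.IsBigTemporary, Bin.IsLight, hc, hjk,
          ind_of_false]

theorem Run.large {I : List ℝ} (hk2 : 2 ≤ k) (hk : k ≤ P.b) (h : Run P I σ)
    (hI : ∀ s ∈ I, 0 < s ∧ s ≤ 1) : (Packing.largeStats β k σ).Inv (P.α 2 k) := by
  induction h with
  | nil =>
    have : Packing.largeStats β k 0 = ⟨0, 0, 0, 0, 0⟩ := by
      simp [Packing.largeStats, Packing.numDeclared, Packing.count_zero, Packing.binCount]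
    rw [this]
    exact ⟨by simp, by simp [LargeStats.bound], by simp [LargeStats.bound], le_rfl, 0, 0, by simp⟩
  | snoc I s σ σ' hI' hs ih =>
    have hI'' : ∀ s ∈ I, 0 < s ∧ s ≤ 1 := fun r hr => hI r (by simp [hr])
    have hα := P.alpha_add hk2 hk
    have hα1 := P.alpha_one_nonneg hk2 hk
    exact (hs.largeEffect hk2 hk (hI'.wf hI'')).inv (P.α_large k hk2 hk).le
      (by linarith) (ih hI'')

end Large

/-- The total of a function over the containers of a packing. -/
noncomputable def Packing.total (g : Container → ℝ) (σ : Packing) : ℝ :=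
  ((Packing.containers σ).map g).sum

section Total

variable {P : Params} {σ : Packing} {g g' : Container → ℝ}

theorem Packing.total_zero : Packing.total g 0 = 0 := by
  simp [Packing.total, Packing.containers]

theorem Packing.total_positive (c : Container) :
    Packing.total g (Bin.positive c ::ₘ σ) = Packing.total g σ + g c := by
  simp [Packing.total, Packing.containers_cons, Bin.containers, add_comm]

theorem Packing.total_negative (d : Container) :
    Packing.total g (Bin.negative d ::ₘ σ) = Packing.total g σ + g d := by
  simp [Packing.total, Packing.containers_cons, Bin.containers, add_comm]

theorem Packing.total_neutral (c d : Container) :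
    Packing.total g (Bin.neutral c d ::ₘ σ) = Packing.total g σ + g c + g d := by
  simp [Packing.total, Packing.containers_cons, Bin.containers]
  ring

theorem Packing.container_wf (hσ : ∀ B ∈ σ, B.WF P) : ∀ c ∈ Packing.containers σ, c.WF P := by
  intro c hc
  obtain ⟨B, hB, hcB⟩ := mem_bind.1 hc
  exact (hσ B hB).container_wf hcB

theorem Packing.total_le (hσ : ∀ B ∈ σ, B.WF P) (h : ∀ c, c.WF P → g c ≤ g' c) :
    Packing.total g σ ≤ Packing.total g' σ :=
  sum_map_le_sum_map _ _ fun c hc => h c (Packing.container_wf hσ c hc)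

theorem Packing.total_congr (hσ : ∀ B ∈ σ, B.WF P) (h : ∀ c, c.WF P → g c = g' c) :
    Packing.total g σ = Packing.total g' σ :=
  congrArg Multiset.sum (map_congr rfl fun c hc => h c (Packing.container_wf hσ c hc))

theorem Packing.total_add :
    Packing.total (fun c => g c + g' c) σ = Packing.total g σ + Packing.total g' σ :=
  sum_map_add

theorem Packing.total_mul (r : ℝ) :
    Packing.total (fun c => g c * r) σ = Packing.total g σ * r :=
  sum_map_mul_right

theorem Packing.total_ind (p : Container → Prop) :
    Packing.total (fun c => (ind (p c) : ℝ)) σ = Packing.count p σ := by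
  induction σ using Multiset.induction_on with
  | empty => simp [Packing.total_zero, Packing.count_zero]
  | cons B σ ih =>
    cases B <;> simp only [Packing.total_positive, Packing.total_negative, Packing.total_neutral,
      Packing.count_positive, Packing.count_negative, Packing.count_neutral, ih] <;> push_cast <;> rfl

theorem Packing.total_finset_sum {ι : Type*} (S : Finset ι) (f : ι → Container → ℝ) :
    Packing.total (fun c => ∑ i ∈ S, f i c) σ = ∑ i ∈ S, Packing.total (f i) σ := by
  simp only [Packing.total]
  induction Packing.containers σ using Multiset.induction_on with
  | empty => simp
  | cons c m ih => simp [ih, Finset.sum_add_distrib]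

theorem Container.WF.type_mem {c : Container} (h : c.WF P) (h2 : 2 ≤ c.cls) :
    c.status.type ∈ Finset.Icc 1 (P.γ c.cls) := by
  by_cases hb : c.cls ≤ P.b
  · rw [P.gamma_large h2 hb]
    rcases h.type_large h2 hb with h | h <;> simp [h]
  · rcases h.statusOK with h | h | ⟨-, i, hi, h1, h3⟩
    · omega
    · omega
    · rw [hi]; exact Finset.mem_Icc.2 ⟨h1, h3⟩

/-- Summing a function of the type over the containers of class `j`. -/
theorem Packing.total_type (hσ : ∀ B ∈ σ, B.WF P) {j : ℕ} (h2 : 2 ≤ j) (f : ℕ → ℝ) :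
    Packing.total (fun c => if c.cls = j then f c.status.type else 0) σ =
      ∑ i ∈ Finset.Icc 1 (P.γ j), (Packing.numType σ i j : ℝ) * f i := by
  simp only [Packing.numType_eq_count, ← Packing.total_ind, ← Packing.total_mul]
  rw [← Packing.total_finset_sum]
  refine Packing.total_congr hσ fun c hc => ?_
  by_cases hj : c.cls = j
  · subst hj
    simp only [true_and, if_true]
    rw [Finset.sum_eq_single c.status.type]
    · rw [ind_of_true rfl]; simp
    · intro i _ hi
      rw [ind_of_false (Ne.symm hi)]; simp
    · intro h
      exact absurd (hc.type_mem h2) h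
  · simp [hj, ind]

theorem Packing.num_eq_sum (hσ : ∀ B ∈ σ, B.WF P) {j : ℕ} (h2 : 2 ≤ j) :
    (Packing.num σ j : ℝ) = ∑ i ∈ Finset.Icc 1 (P.γ j), (Packing.numType σ i j : ℝ) := by
  have := Packing.total_type hσ h2 (fun _ => 1)
  simp only [mul_one] at this
  rw [← this, Packing.num_eq_count, ← Packing.total_ind]
  simp [ind]

end Total

section Basic

/-- The guaranteed contents of a closed container of type `i` of class `j`: the number of its
items, or their total size for the tiny class. -/
noncomputable def Params.fill (P : Params) (j i : ℕ) : ℝ :=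
  if j = P.M + 1 then P.tinyCap i - P.t P.M else i

/-- The contents of a container of class `j`. -/
noncomputable def Params.contents (P : Params) (j : ℕ) (c : Container) : ℝ :=
  if j = P.M + 1 then c.items.sum else c.items.card

/-- A container of class `j` that may still receive an item. -/
def Params.Incomplete (P : Params) (j : ℕ) (c : Container) : Prop :=
  c.cls = j ∧ if j ≤ P.b then c.status = .declared2 else c.IsOpen P

variable {P : Params} {j : ℕ}

theorem Params.gamma_last (P : Params) : P.γ (P.M + 1) = P.p := if_pos rfl

theorem fill_nonneg {i : ℕ} (hi : i ∈ Finset.Icc 1 (P.γ j)) : 0 ≤ P.fill j i := by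
  unfold Params.fill
  split_ifs with h
  · subst h
    rw [P.gamma_last, Finset.mem_Icc] at hi
    linarith [P.tinyCap_le hi.1 hi.2]
  · positivity

theorem fill_le_sum {i : ℕ} (hi : i ∈ Finset.Icc 1 (P.γ j)) :
    P.fill j i ≤ ∑ i ∈ Finset.Icc 1 (P.γ j), P.fill j i :=
  Finset.single_le_sum (fun _ h => fill_nonneg h) hi

theorem sum_fill_mul_pos (h2 : 2 ≤ j) (hj : j ≤ P.M + 1) :
    0 < ∑ i ∈ Finset.Icc 1 (P.γ j), P.fill j i * P.α i j := by
  by_cases h : j = P.M + 1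
  · subst h
    simpa [Params.fill, P.gamma_last] using P.tiny_denom_pos
  · have : ∑ i ∈ Finset.Icc 1 (P.γ j), P.α i j ≤
        ∑ i ∈ Finset.Icc 1 (P.γ j), P.fill j i * P.α i j := by
      refine Finset.sum_le_sum fun i hi => ?_
      have h1 : (1 : ℝ) ≤ i := by exact_mod_cast (Finset.mem_Icc.1 hi).1
      rw [Params.fill, if_neg h]
      nlinarith [P.alpha_nonneg h2 hj hi]
    rw [P.alpha_sum h2 hj] at this
    linarith

theorem Container.WF.fill_le {c : Container} (h : c.WF P) (h2 : 2 ≤ c.cls) :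
    P.fill c.cls c.status.type ≤ P.contents c.cls c +
      ind (P.Incomplete c.cls c) * ∑ i ∈ Finset.Icc 1 (P.γ c.cls), P.fill c.cls i := by
  have hbM := P.b_le
  have hmem := h.type_mem h2
  have hle := fill_le_sum hmem
  have hc0 : 0 ≤ P.contents c.cls c := by
    unfold Params.contents
    split_ifs
    · exact sum_nonneg fun x hx => (h.items x hx).1.le
    · positivity
  by_cases hi : P.Incomplete c.cls c
  · rw [ind_of_true hi]
    push_cast
    linarith
  rw [ind_of_false hi, Nat.cast_zero, zero_mul, add_zero]
  rcases h.statusOK with h | ⟨-, hb, hst⟩ | ⟨hb, i, hst, h1, h3⟩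
  · omega
  · rw [Params.fill, Params.contents, if_neg (by omega), if_neg (by omega), Nat.cast_le]
    rcases hst with ⟨hcard, hst | hst | hst⟩ | ⟨hcard, hst⟩
    · rw [hcard, hst]; rfl
    · rw [hcard, hst]; rfl
    · exact absurd ⟨rfl, by rwa [if_pos hb]⟩ hi
    · rw [hcard, hst]; rfl
  · have hopen : ¬ c.IsOpen P := fun ho => hi ⟨rfl, by rwa [if_neg (by omega)]⟩
    simp only [Container.IsOpen, not_or, not_and, not_lt, not_le] at hopen
    by_cases hM : c.cls = P.M + 1
    · rw [Params.fill, Params.contents, if_pos hM, if_pos hM]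
      have hpos : 0 < c.items.sum := by
        obtain ⟨s, hs⟩ := exists_mem_of_ne_zero h.ne_zero
        exact (h.items s hs).1.trans_le
          (single_le_sum (fun x hx => (h.items x hx).1.le) s hs)
      have := hopen.2 hM hpos
      rw [Params.A, if_pos hM] at this
      exact this.le
    · rw [Params.fill, Params.contents, if_neg hM, if_neg hM, Nat.cast_le]
      exact hopen.1 hb (by have := h.cls_mem.2; omega)

variable {σ : Packing} {I : List ℝ}

theorem Run.incomplete_le (h : Run P I σ) (hI : ∀ s ∈ I, 0 < s ∧ s ≤ 1) (h2 : 2 ≤ j)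
    (hj : j ≤ P.M + 1) : Packing.count (P.Incomplete j) σ ≤ 2 := by
  by_cases hb : j ≤ P.b
  · have := h.large (β := 0) h2 hb hI
    have h3 := this.declared_le
    have h4 := this.two_le
    have h5 : (Packing.largeStats 0 j σ).declared = Packing.count (P.Incomplete j) σ := by
      have : P.Incomplete j = fun c => c.cls = j ∧ c.status = .declared2 := by
        funext c; simp only [Params.Incomplete, if_pos hb]
      rw [this]; rfl
    omega
  · have := (h.small (not_le.1 hb) hj hI).1
    have h5 : Packing.numOpen P σ j = Packing.count (P.Incomplete j) σ := by
      have : P.Incomplete j = fun c => c.cls = j ∧ c.IsOpen P := by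
        funext c; simp only [Params.Incomplete, if_neg hb]
      rw [this]; rfl
    omega

theorem Run.numType_le (h : Run P I σ) (hI : ∀ s ∈ I, 0 < s ∧ s ≤ 1) (h2 : 2 ≤ j)
    (hj : j ≤ P.M + 1) {i : ℕ} (hi : i ∈ Finset.Icc 1 (P.γ j)) :
    (Packing.numType σ i j : ℝ) ≤ P.α i j * Packing.num σ j + 2 := by
  by_cases hb : j ≤ P.b
  · have hinv := h.large (β := 0) h2 hb hI
    have hα := P.alpha_add h2 hb
    have hα2 := (P.α_large j h2 hb)
    have hnum := num_eq_one_add_two (β := 0) σ (h.wf hI) h2 hb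
    have h3 := hinv.two_le
    have h4 := hinv.le_two
    simp only [LargeStats.bound, ← hnum] at h3 h4
    have e1 : Packing.numType σ 1 j = (Packing.largeStats 0 j σ).one :=
      Packing.numType_eq_count _ _ _
    have e2 : Packing.numType σ 2 j = (Packing.largeStats 0 j σ).two :=
      Packing.numType_eq_count _ _ _
    rw [← e2] at h3 h4
    rw [← e1, ← e2] at hnum
    have h5 : (Packing.numType σ 2 j : ℝ) ≤ P.α 2 j * Packing.num σ j :=
      (Nat.cast_le.2 h3).trans (Nat.floor_le (by positivity))
    have h6 : P.α 2 j * Packing.num σ j < Packing.numType σ 2 j + 1 + 1 :=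
      (Nat.lt_floor_add_one _).trans_le (by exact_mod_cast Nat.add_le_add_right h4 1)
    have h7 : (Packing.num σ j : ℝ) = Packing.numType σ 1 j + Packing.numType σ 2 j := by
      exact_mod_cast hnum
    rw [P.gamma_large h2 hb, Finset.mem_Icc] at hi
    have : i = 1 ∨ i = 2 := by omega
    rcases this with rfl | rfl
    · have : P.α 1 j = 1 - P.α 2 j := by linarith
      rw [this]
      linarith
    · linarith
  · linarith [(h.small (not_le.1 hb) hj hI).2 i hi]

theorem Run.le_numType (h : Run P I σ) (hI : ∀ s ∈ I, 0 < s ∧ s ≤ 1) (h2 : 2 ≤ j)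
    (hj : j ≤ P.M + 1) {i : ℕ} (hi : i ∈ Finset.Icc 1 (P.γ j)) :
    P.α i j * Packing.num σ j - 2 * P.γ j ≤ Packing.numType σ i j := by
  have hs := Packing.num_eq_sum (h.wf hI) h2
  have hα := P.alpha_sum h2 hj
  have h1 : ∀ i ∈ Finset.Icc 1 (P.γ j),
      0 ≤ P.α i j * Packing.num σ j + 2 - Packing.numType σ i j :=
    fun i hi => by linarith [h.numType_le hI h2 hj hi]
  have h3 := Finset.single_le_sum h1 hi
  have h4 : ∑ i ∈ Finset.Icc 1 (P.γ j), (P.α i j * Packing.num σ j + 2 - Packing.numType σ i j)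
      = 2 * P.γ j := by
    rw [Finset.sum_sub_distrib, Finset.sum_add_distrib, ← Finset.sum_mul, hα, ← hs]
    simp
    ring
  rw [h4] at h3
  linarith

/-- The additive error in the accounting of a basic class. -/
noncomputable def Params.classError (P : Params) (j : ℕ) : ℝ :=
  2 * P.γ j + (2 * P.γ j + 2) * (∑ i ∈ Finset.Icc 1 (P.γ j), P.fill j i) /
    ∑ i ∈ Finset.Icc 1 (P.γ j), P.fill j i * P.α i j

/-- The total of `r` over the types of the containers of class `j` is covered by the contents of
these containers. -/
theorem Run.total_type_le (h : Run P I σ) (hI : ∀ s ∈ I, 0 < s ∧ s ≤ 1) (h2 : 2 ≤ j)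
    (hj : j ≤ P.M + 1) {r : ℕ → ℝ} (hr0 : ∀ i, 0 ≤ r i) (hr1 : ∀ i, r i ≤ 1) :
    Packing.total (fun c => if c.cls = j then r c.status.type else 0) σ ≤
      Packing.total (fun c => if c.cls = j then P.contents j c else 0) σ *
        ((∑ i ∈ Finset.Icc 1 (P.γ j), P.α i j * r i) /
          ∑ i ∈ Finset.Icc 1 (P.γ j), P.fill j i * P.α i j) + P.classError j := by
  have hwf := h.wf hI
  set S := Finset.Icc 1 (P.γ j) with hS
  set R := ∑ i ∈ S, P.α i j * r i with hR
  set Λ := ∑ i ∈ S, P.fill j i * P.α i j with hΛ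
  set F := ∑ i ∈ S, P.fill j i with hF
  set N : ℝ := (Packing.num σ j : ℝ) with hN
  have hΛ0 : 0 < Λ := sum_fill_mul_pos h2 hj
  have hF0 : 0 ≤ F := Finset.sum_nonneg fun i hi => fill_nonneg hi
  have hR0 : 0 ≤ R := Finset.sum_nonneg fun i hi => mul_nonneg (P.alpha_nonneg h2 hj hi) (hr0 i)
  have hR1 : R ≤ 1 := by
    rw [← P.alpha_sum h2 hj]
    exact Finset.sum_le_sum fun i hi =>
      mul_le_of_le_one_right (P.alpha_nonneg h2 hj hi) (hr1 i)
  have hreq : Packing.total (fun c => if c.cls = j then r c.status.type else 0) σ ≤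
      N * R + 2 * P.γ j := by
    rw [Packing.total_type hwf h2, hR, Finset.mul_sum]
    have : ∑ i ∈ S, (2 : ℝ) = 2 * P.γ j := by simp [hS, mul_comm]
    rw [← this, ← Finset.sum_add_distrib]
    refine Finset.sum_le_sum fun i hi => ?_
    have := h.numType_le hI h2 hj hi
    nlinarith [hr0 i, hr1 i]
  have hfill : N * Λ - 2 * P.γ j * F ≤ ∑ i ∈ S, (Packing.numType σ i j : ℝ) * P.fill j i := by
    rw [hΛ, hF, Finset.mul_sum, Finset.mul_sum, ← Finset.sum_sub_distrib]
    refine Finset.sum_le_sum fun i hi => ?_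
    have := h.le_numType hI h2 hj hi
    nlinarith [fill_nonneg hi]
  have hcont : ∑ i ∈ S, (Packing.numType σ i j : ℝ) * P.fill j i ≤
      Packing.total (fun c => if c.cls = j then P.contents j c else 0) σ + 2 * F := by
    have hinc : (Packing.count (P.Incomplete j) σ : ℝ) ≤ 2 := by
      exact_mod_cast h.incomplete_le hI h2 hj
    have : Packing.total (fun c => if c.cls = j then P.fill j c.status.type else 0) σ ≤
        Packing.total (fun c => (if c.cls = j then P.contents j c else 0) +
          ind (P.Incomplete j c) * F) σ := by
      refine Packing.total_le hwf fun c hc => ?_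
      by_cases hcj : c.cls = j
      · subst hcj
        simpa using hc.fill_le h2
      · simp only [hcj, if_false, zero_add]
        positivity
    rw [Packing.total_type hwf h2, Packing.total_add, Packing.total_mul, Packing.total_ind] at this
    nlinarith
  have hRΛ : 0 ≤ R / Λ := by positivity
  have hq : R / Λ ≤ 1 / Λ := by gcongr
  have h5 : (N * Λ - (2 * P.γ j + 2) * F) * (R / Λ) ≤
      Packing.total (fun c => if c.cls = j then P.contents j c else 0) σ * (R / Λ) :=
    mul_le_mul_of_nonneg_right (by linarith) hRΛ
  have h6 : N * Λ * (R / Λ) = N * R := by field_simp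
  have h7 : (2 * P.γ j + 2) * F * (R / Λ) ≤ (2 * P.γ j + 2) * F / Λ := by
    rw [div_eq_mul_one_div (_ * F) Λ]
    exact mul_le_mul_of_nonneg_left hq (by positivity)
  rw [Params.classError]
  linarith

end Basic

section Need

variable {P : Params} {a w z : ℝ} {k j : ℕ} {c : Container} {σ : Packing}

/-- The weight needed by a container, which is `z` if it is of class `k` and this class is large. -/
noncomputable def Container.need (P : Params) (a w : ℝ) (k : ℕ) (z : ℝ) (c : Container) : ℝ :=
  if c.cls = k ∧ k ≤ P.b then z else required a w (c.volume P)

open scoped Classical in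
/-- The weight needed by the containers of class `j` in a bin. -/
noncomputable def Bin.classNeed (P : Params) (a w : ℝ) (k j : ℕ) : Bin → ℝ
  | .positive c => if c.cls = j then c.need P a w k 1 else 0
  | .negative d => if d.cls = j then d.need P a w k 1 else 0
  | .neutral c d => (if c.cls = j then c.need P a w k w else 0) +
      if d.cls = j then d.need P a w k (1 - w) else 0

theorem required_nonneg (h0 : 0 ≤ w) (h1 : w ≤ 1) (x : ℝ) : 0 ≤ required a w x := by
  unfold required
  split_ifs <;> linarith

theorem required_le_one (h0 : 0 ≤ w) (h1 : w ≤ 1) (x : ℝ) : required a w x ≤ 1 := by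
  unfold required
  split_ifs <;> linarith

theorem le_required_of_half_lt (h1 : w ≤ 1) {x : ℝ} (hx : 1 / 2 < x) : w ≤ required a w x := by
  rw [required, if_pos hx]
  split_ifs <;> linarith

theorem le_required_of_le_half (h0 : 0 ≤ w) {x : ℝ} (hx : x ≤ 1 / 2) :
    1 - w ≤ required a w x := by
  rw [required, if_neg (not_lt.2 hx)]
  split_ifs <;> linarith

/-- In the final packing the needs of the containers of a bin add up to at least `1`. -/
theorem one_le_sum_classNeed (h0 : 0 ≤ w) (h1 : w ≤ 1) {B : Bin} (hB : B.WF P)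
    (hpos : ∀ c, B = .positive c → a ≤ c.volume P)
    (hneg : ∀ d, B = .negative d → 1 - a < d.volume P) :
    1 ≤ ∑ j ∈ Finset.Icc 1 (P.M + 1), B.classNeed P a w k j := by
  have hmem : ∀ c : Container, c.WF P → c.cls ∈ Finset.Icc 1 (P.M + 1) := fun c hc =>
    Finset.mem_Icc.2 hc.cls_mem
  cases B with
  | positive c =>
    simp only [Bin.classNeed]
    rw [Finset.sum_ite_eq, if_pos (hmem c hB.1), Container.need, required, if_pos hB.2,
      if_pos (hpos c rfl)]
    split_ifs <;> rfl
  | negative d =>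
    simp only [Bin.classNeed]
    rw [Finset.sum_ite_eq, if_pos (hmem d hB.1), Container.need, required,
      if_neg (not_lt.2 hB.2.1), if_neg (not_le.2 (hneg d rfl))]
    split_ifs <;> rfl
  | neutral c d =>
    simp only [Bin.classNeed]
    rw [Finset.sum_add_distrib, Finset.sum_ite_eq, Finset.sum_ite_eq, if_pos (hmem c hB.1),
      if_pos (hmem d hB.2.2.1), Container.need, Container.need]
    have hc := le_required_of_half_lt (a := a) h1 hB.2.1
    have hd := le_required_of_le_half (a := a) h0 hB.2.2.2.1
    split_ifs <;> linarith

theorem card_le_sum_classNeed (h : ∀ B ∈ σ, 1 ≤ ∑ j ∈ Finset.Icc 1 (P.M + 1),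
    B.classNeed P a w k j) :
    (card σ : ℝ) ≤ ∑ j ∈ Finset.Icc 1 (P.M + 1), (σ.map (Bin.classNeed P a w k j)).sum := by
  induction σ using Multiset.induction_on with
  | empty => simp
  | cons B σ ih =>
    rw [forall_mem_cons] at h
    simp only [card_cons, map_cons, sum_cons, Finset.sum_add_distrib]
    push_cast
    linarith [h.1, ih h.2]

/-- The total weight needed by the containers of a basic class. -/
theorem sum_classNeed_basic (hj : ¬ (j = k ∧ k ≤ P.b)) :
    (σ.map (Bin.classNeed P a w k j)).sum =
      Packing.total (fun c => if c.cls = j then required a w (c.volume P) else 0) σ := by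
  have key : ∀ (z : ℝ) (c : Container), (if c.cls = j then c.need P a w k z else 0) =
      if c.cls = j then required a w (c.volume P) else 0 := by
    intro z c
    by_cases hc : c.cls = j
    · rw [if_pos hc, if_pos hc, Container.need, if_neg (hc ▸ hj)]
    · rw [if_neg hc, if_neg hc]
  induction σ using Multiset.induction_on with
  | empty => simp [Packing.total_zero]
  | cons B σ ih =>
    rw [map_cons, sum_cons, ih]
    cases B <;> simp only [Bin.classNeed, key, Packing.total_positive, Packing.total_negative,
      Packing.total_neutral] <;> ring

end Need

section Weights

variable {P : Params} {a u v w : ℝ} {k j : ℕ} {c : Container} {σ : Packing} {I : List ℝ}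

/-- The total weight of the items in a container. -/
noncomputable def Container.weight (P : Params) (a : ℝ) (k : ℕ) (u v w : ℝ) (c : Container) : ℝ :=
  (c.items.map (itemWeight P a k u v w)).sum

/-- The total weight of the items of class `j` of a packing. -/
noncomputable def Packing.classTotal (P : Params) (a : ℝ) (k : ℕ) (u v w : ℝ) (j : ℕ)
    (σ : Packing) : ℝ :=
  Packing.total (fun c => if c.cls = j then c.weight P a k u v w else 0) σ

theorem Run.totalWeight_eq (h : Run P I σ) (hI : ∀ s ∈ I, 0 < s ∧ s ≤ 1) :
    totalWeight P a k u v w I =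
      ∑ j ∈ Finset.Icc 1 (P.M + 1), Packing.classTotal P a k u v w j σ := by
  have h1 : totalWeight P a k u v w I = Packing.total (Container.weight P a k u v w) σ := by
    rw [totalWeight, ← sum_coe, ← map_coe, ← h.items, Packing.items, map_bind, sum_bind]
    rfl
  rw [h1]
  simp only [Packing.classTotal]
  rw [← Packing.total_finset_sum]
  refine Packing.total_congr (h.wf hI) fun c hc => ?_
  rw [Finset.sum_ite_eq, if_pos (Finset.mem_Icc.2 hc.cls_mem)]

theorem Container.WF.weight_huge (hc : c.WF P) (h1 : c.cls = 1) :
    c.weight P a k u v w = required a w (c.volume P) := by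
  obtain ⟨-, s, hs, hv, hs2⟩ := hc.volume_huge h1
  have hcl : P.classOf s = 1 := h1 ▸ (hc.items s (by simp [hs])).2.2
  rw [Container.weight, hs, hv, map_singleton, sum_singleton, itemWeight, if_pos hcl, required,
    if_pos hs2]

theorem Container.WF.weight_basic (hc : c.WF P) (h2 : 2 ≤ c.cls)
    (hk : ¬ (c.cls = k ∧ k ≤ P.b)) :
    c.weight P a k u v w = P.contents c.cls c *
      ((∑ i ∈ Finset.Icc 1 (P.γ c.cls), P.α i c.cls * requiredType P a w i c.cls) /
        ∑ i ∈ Finset.Icc 1 (P.γ c.cls), P.fill c.cls i * P.α i c.cls) := by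
  by_cases hM : c.cls = P.M + 1
  · have h3 : ∀ s ∈ c.items, itemWeight P a k u v w s = s * tinyDensity P a w := by
      intro s hs
      have hcl := (hc.items s hs).2.2
      rw [itemWeight, hcl, if_neg (by omega), if_neg hk, if_pos hM]
    rw [Container.weight, map_congr rfl h3, sum_map_mul_right, map_id', Params.contents, if_pos hM,
      hM, P.gamma_last, tinyDensity]
    simp only [Params.fill, Params.A, if_true]
  · have h3 : ∀ s ∈ c.items, itemWeight P a k u v w s = classWeight P a w c.cls := by
      intro s hs
      have hcl := (hc.items s hs).2.2
      rw [itemWeight, hcl, if_neg (by omega), if_neg hk, if_neg hM]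
    rw [Container.weight, map_congr rfl h3, Multiset.map_const', sum_replicate, nsmul_eq_mul,
      Params.contents, if_neg hM, classWeight]
    simp only [Params.fill, hM, if_false]

/-- The required weight of a container of a basic class depends only on its type. -/
theorem Container.WF.required_basic (hc : c.WF P) (h2 : 2 ≤ c.cls)
    (hk : ¬ (c.cls = k ∧ k ≤ P.b)) (hk1 : 1 ≤ k) (hkM : k ≤ P.M + 1)
    (ha : 1 - a ∈ Set.Ioc (P.t k) (P.t (k - 1))) :
    required a w (c.volume P) = requiredType P a w c.status.type c.cls := by
  rw [requiredType]
  by_cases hv : c.status.type = 1 ∧ c.cls ≤ P.b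
  · obtain ⟨h1, hb⟩ := hv
    have hbM := P.b_le
    obtain ⟨s, -, hvol, hs⟩ := hc.exists_item hb h1
    have hhalf := (P.t_large h2 hb).2
    have hA : P.A c.status.type c.cls = P.t (c.cls - 1) := by
      rw [h1, Params.A, if_neg (by omega)]; simp
    rw [hvol, hA, required, required, if_neg (not_lt.2 (hs.2.trans hhalf)),
      if_neg (not_lt.2 hhalf)]
    have hiff : s ≤ 1 - a ↔ P.t (c.cls - 1) ≤ 1 - a := by
      constructor
      · intro h
        by_contra hcon
        push Not at hcon
        rcases lt_trichotomy c.cls k with hlt | heq | hgt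
        · have := P.t_le_of_le (m := c.cls) (n := k - 1) (by omega) (by omega)
          linarith [hs.1, ha.2]
        · exact hk ⟨heq, heq ▸ hb⟩
        · have := P.t_le_of_le (m := k) (n := c.cls - 1) (by omega) (by omega)
          linarith [ha.1]
      · exact hs.2.trans
    simp only [hiff]
  · rw [Container.volume, if_neg hv]

theorem Run.huge_le (h : Run P I σ) (hI : ∀ s ∈ I, 0 < s ∧ s ≤ 1) (hk : ¬ (1 = k ∧ k ≤ P.b)) :
    (σ.map (Bin.classNeed P a w k 1)).sum ≤ Packing.classTotal P a k u v w 1 σ := by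
  rw [sum_classNeed_basic hk, Packing.classTotal]
  refine Packing.total_le (h.wf hI) fun c hc => ?_
  split_ifs with h1
  · exact (hc.weight_huge h1).ge
  · exact le_rfl

theorem Run.basic_le (h : Run P I σ) (hI : ∀ s ∈ I, 0 < s ∧ s ≤ 1) (h2 : 2 ≤ j)
    (hj : j ≤ P.M + 1) (hk : ¬ (j = k ∧ k ≤ P.b)) (hk1 : 1 ≤ k) (hkM : k ≤ P.M + 1)
    (ha : 1 - a ∈ Set.Ioc (P.t k) (P.t (k - 1))) (h0 : 0 ≤ w) (h1 : w ≤ 1) :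
    (σ.map (Bin.classNeed P a w k j)).sum ≤
      Packing.classTotal P a k u v w j σ + P.classError j := by
  have hmain := h.total_type_le hI h2 hj (r := fun i => requiredType P a w i j)
    (fun i => required_nonneg h0 h1 _) (fun i => required_le_one h0 h1 _)
  rw [sum_classNeed_basic hk, Packing.classTotal]
  have e1 : Packing.total (fun c => if c.cls = j then required a w (c.volume P) else 0) σ =
      Packing.total (fun c => if c.cls = j then requiredType P a w c.status.type j else 0) σ := by
    refine Packing.total_congr (h.wf hI) fun c hc => ?_
    by_cases hcj : c.cls = j
    · subst hcj
      rw [if_pos rfl, if_pos rfl, hc.required_basic h2 hk hk1 hkM ha]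
    · rw [if_neg hcj, if_neg hcj]
  rw [e1]
  refine hmain.trans_eq ?_
  rw [← Packing.total_mul]
  congr 1
  refine Packing.total_congr (h.wf hI) fun c hc => ?_
  by_cases hcj : c.cls = j
  · subst hcj
    rw [if_pos rfl, if_pos rfl, hc.weight_basic h2 hk]
  · rw [if_neg hcj, if_neg hcj, zero_mul]

end Weights

section Threshold

variable {P : Params} {a u v w : ℝ} {k : ℕ} {c : Container} {σ : Packing} {I : List ℝ}

theorem large_class_arithmetic {α₁ α₂ one two decl big light m₁ m₂ : ℝ}
    (hα : α₁ + α₂ = 1) (hα₂ : 0 ≤ α₂) (hw0 : 0 ≤ w) (hw1 : w ≤ 1) (hu0 : 0 ≤ u)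
    (hu1 : u ≤ 1) (hv0 : 0 ≤ v) (hv1 : v ≤ 1) (huv : u ≤ v)
    (h1 : 1 ≤ u * (1 + α₂) + w * α₁) (h2 : 1 ≤ u * α₂ + v)
    (h3 : 1 ≤ v * α₁ + 2 * u * α₂ + (1 - w) * α₂)
    (e1 : two ≤ α₂ * (one + two)) (e2 : α₂ * (one + two) ≤ two + 2) (hd : decl ≤ 2)
    (f1 : m₂ ≤ α₂ * (m₁ + m₂)) (f2 : α₂ * (m₁ + m₂) ≤ m₂ + 2) (hm : 0 ≤ m₁ + m₂)
    (hbig0 : 0 ≤ big) (g1 : m₁ + big ≤ one) (g2 : light ≤ m₂) (g3 : m₂ ≤ two) :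
    big * (1 - v) + (one - big) * (1 - w - u) + light * (1 - 2 * u) +
      (two - light) * -min (u + v - 1) (2 * u - w) + decl ≤ 12 := by
  set Y := min (u + v - 1) (2 * u - w) with hY
  set X := min (v - 1) (u + w - 1) with hX
  have hX1 : X ≤ v - 1 := min_le_left _ _
  have hX2 : X ≤ u + w - 1 := min_le_right _ _
  have hY1 : Y ≤ u + v - 1 := min_le_left _ _
  have hX3 : -1 ≤ X := le_min (by linarith) (by linarith)
  have hY3 : 2 * u - 1 ≤ Y := le_min (by linarith) (by linarith)
  have hXY : 0 ≤ α₁ * X + α₂ * Y := by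
    rcases min_choice (v - 1) (u + w - 1) with hx | hx <;>
      rcases min_choice (u + v - 1) (2 * u - w) with hy | hy <;>
      rw [hX, hY, hx, hy] <;> nlinarith
  have s1 : big * (1 - v) + (one - big) * (1 - w - u) ≤
      m₁ * (1 - w - u) + (one - m₁) * -X := by
    nlinarith [mul_nonneg hbig0 (sub_nonneg.2 hX1),
      mul_nonneg (sub_nonneg.2 g1) (sub_nonneg.2 hX2)]
  have s2 : light * (1 - 2 * u) + (two - light) * -Y ≤ m₂ * (1 - 2 * u) + (two - m₂) * -Y := by
    nlinarith [mul_nonneg (sub_nonneg.2 g2) (sub_nonneg.2 hY3)]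
  obtain ⟨e, he⟩ : ∃ e, e = α₂ * (m₁ + m₂) - m₂ := ⟨_, rfl⟩
  obtain ⟨e', he'⟩ : ∃ e', e' = α₂ * (one + two) - two := ⟨_, rfl⟩
  have t1 : m₁ * (1 - w - u) + m₂ * (1 - 2 * u) =
      (m₁ + m₂) * (1 - (u * (1 + α₂) + w * α₁)) + e * (u - w) := by
    have : α₁ = 1 - α₂ := by linarith
    rw [he, this]; ring
  have t2 : (one - m₁) * -X + (two - m₂) * -Y =
      -((one + two - (m₁ + m₂)) * (α₁ * X + α₂ * Y)) + (e' - e) * (Y - X) := by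
    have : α₁ = 1 - α₂ := by linarith
    rw [he, he', this]; ring
  have t3 : (m₁ + m₂) * (1 - (u * (1 + α₂) + w * α₁)) ≤ 0 :=
    mul_nonpos_of_nonneg_of_nonpos hm (by linarith)
  have t4 : 0 ≤ (one + two - (m₁ + m₂)) * (α₁ * X + α₂ * Y) :=
    mul_nonneg (by linarith) hXY
  have t5 : e * (u - w) ≤ 2 := by nlinarith
  have t6 : (e' - e) * (Y - X) ≤ 4 := by
    have : |e' - e| ≤ 2 := abs_le.2 ⟨by linarith, by linarith⟩
    have h' : |Y - X| ≤ 2 := abs_le.2 ⟨by linarith, by linarith⟩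
    calc (e' - e) * (Y - X) ≤ |(e' - e) * (Y - X)| := le_abs_self _
      _ = |e' - e| * |Y - X| := abs_mul _ _
      _ ≤ 2 * 2 := mul_le_mul this h' (abs_nonneg _) (by norm_num)
      _ = 4 := by norm_num
  linarith

theorem itemWeight_threshold {s : ℝ} (hk2 : 2 ≤ k) (hk : k ≤ P.b) (hs : P.classOf s = k) :
    itemWeight P a k u v w s = if s ≤ 1 - a then u else v := by
  rw [itemWeight, hs, if_neg (by omega), if_pos ⟨rfl, hk⟩]

theorem Container.WF.weight_type_one (hc : c.WF P) (hck : c.cls = k) (hk2 : 2 ≤ k)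
    (hk : k ≤ P.b) (ht : c.status.type = 1) :
    c.weight P a k u v w = if c.items.sum ≤ 1 - a then u else v := by
  obtain ⟨s, hs, -⟩ := hc.exists_item (hck ▸ hk) ht
  rw [Container.weight, hs, map_singleton, sum_singleton, sum_singleton,
    itemWeight_threshold hk2 hk (hck ▸ (hc.items s (by simp [hs])).2.2)]

/-- The weight of the items of a type 2 container of the large class `k`. -/
theorem Container.WF.le_weight_type_two (hc : c.WF P) (hck : c.cls = k) (hk2 : 2 ≤ k)
    (hk : k ≤ P.b) (ht : c.status.type = 2) (hu1 : u ≤ 1) (huv : u ≤ v) :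
    2 * u ≤ c.weight P a k u v w + ind (c.cls = k ∧ c.status = .declared2) ∧
      (¬ (c.cls = k ∧ ∀ s ∈ c.items, s ≤ 1 - a) →
        u + v ≤ c.weight P a k u v w + ind (c.cls = k ∧ c.status = .declared2)) := by
  have hw : ∀ s ∈ c.items, itemWeight P a k u v w s = if s ≤ 1 - a then u else v :=
    fun s hs => itemWeight_threshold hk2 hk (hck ▸ (hc.items s hs).2.2)
  rw [Container.weight, map_congr rfl hw]
  rcases hc.statusOK with h | ⟨-, -, ⟨hcard, hst | hst | hst⟩ | ⟨hcard, hst⟩⟩ | h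
  · omega
  · rw [hst] at ht; simp [Status.type] at ht
  · rw [hst] at ht; simp [Status.type] at ht
  · obtain ⟨r, hr⟩ := card_eq_one.1 hcard
    rw [ind_of_true ⟨hck, hst⟩, hr]
    simp only [map_singleton, sum_singleton, mem_singleton, forall_eq, hck, true_and, Nat.cast_one]
    split_ifs with h
    · exact ⟨by linarith, fun h' => absurd h h'⟩
    · exact ⟨by linarith, fun _ => by linarith⟩
  · obtain ⟨r, r', hr⟩ := card_eq_two.1 hcard
    rw [ind_of_false (by simp [hst]), hr]
    simp only [insert_eq_cons, map_cons, sum_cons, map_singleton, sum_singleton, mem_cons,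
      mem_singleton, forall_eq_or_imp, forall_eq, hck, true_and, Nat.cast_zero, add_zero]
    split_ifs with h h' h'
    · exact ⟨by linarith, fun h'' => absurd ⟨h, h'⟩ h''⟩
    all_goals exact ⟨by linarith, fun _ => by linarith⟩
  · omega

/-- The weight needed by the containers of the large class `k` in excess of the weight of their
items, in terms of the numbers of containers of the different kinds. -/
theorem sum_classNeed_threshold_le (hσ : ∀ B ∈ σ, B.WF P)
    (hneg : ∀ d, Bin.negative d ∈ σ → 1 - a < d.volume P) (hk2 : 2 ≤ k) (hk : k ≤ P.b)
    (hu1 : u ≤ 1) (huv : u ≤ v) {x : LargeStats}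
    (hx : x = Packing.largeStats (1 - a) k σ) :
    (σ.map (Bin.classNeed P a w k k)).sum ≤ Packing.classTotal P a k u v w k σ +
      (x.bigTemp * (1 - v) + (x.one - x.bigTemp) * (1 - w - u) + x.light * (1 - 2 * u) +
        (x.two - x.light) * -min (u + v - 1) (2 * u - w) + x.declared) := by
  subst hx
  set Y := min (u + v - 1) (2 * u - w) with hY
  have hY1 : Y ≤ u + v - 1 := min_le_left _ _
  have hY2 : Y ≤ 2 * u - w := min_le_right _ _
  have hneed : ∀ (z : ℝ) (c : Container), c.cls = k → c.need P a w k z = z :=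
    fun z c hc => if_pos ⟨hc, hk⟩
  simp only [Packing.largeStats, Packing.numDeclared, Packing.classTotal]
  induction σ using Multiset.induction_on with
  | empty => simp [Packing.total_zero, Packing.count_zero, Packing.binCount]
  | cons B σ ih =>
    rw [forall_mem_cons] at hσ
    have ih := ih hσ.2 fun d hd => hneg d (mem_cons_of_mem hd)
    rw [map_cons, sum_cons]
    cases B with
    | positive c =>
      simp only [Packing.total_positive, Packing.count_positive, Packing.binCount_cons,
        Bin.classNeed, Bin.IsBigTemporary, Bin.IsLight, ind_of_false (p := False) id]
      by_cases hck : c.cls = k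
      · have ht := hσ.1.1.type_of_half_lt (hck ▸ hk2) (hck ▸ hk) hσ.1.2
        obtain ⟨w1, w2⟩ := hσ.1.1.le_weight_type_two (a := a) (w := w) hck hk2 hk ht hu1 huv
        rw [if_pos hck, if_pos hck, hneed 1 c hck, ind_of_true (p := c.cls = k ∧ _ = 2) ⟨hck, ht⟩,
          ind_of_false (p := c.cls = k ∧ _ = 1) (by omega)]
        by_cases hl : c.cls = k ∧ ∀ s ∈ c.items, s ≤ 1 - a
        · rw [ind_of_true hl]
          push_cast
          linarith
        · have w2 := w2 hl
          rw [ind_of_false hl]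
          push_cast
          linarith
      · simpa [hck, ind] using ih
    | negative d =>
      simp only [Packing.total_negative, Packing.count_negative, Packing.binCount_cons,
        Bin.classNeed, Bin.IsBigTemporary, Bin.IsLight, ind_of_false (p := False) id]
      by_cases hck : d.cls = k
      · have ht := hσ.1.1.type_of_le_half (hck ▸ hk2) (hck ▸ hk) hσ.1.2.1
        have hv := hneg d (mem_cons_self _ _)
        rw [Container.volume_of_type_one ht (hck ▸ hk)] at hv
        have hst : d.status = .temporary1 := by
          rcases hσ.1.1.statusOK with h | ⟨-, -, ⟨-, h | h | h⟩ | ⟨-, h⟩⟩ | h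
          · omega
          · exact absurd h hσ.1.2.2
          · exact h
          · rw [h] at ht; simp [Status.type] at ht
          · rw [h] at ht; simp [Status.type] at ht
          · omega
        rw [if_pos hck, if_pos hck, hneed 1 d hck, ind_of_true (p := d.cls = k ∧ _ = 1) ⟨hck, ht⟩,
          ind_of_false (p := d.cls = k ∧ _ = 2) (by omega), ind_of_true ⟨hck, hst, hv⟩,
          ind_of_false (p := d.cls = k ∧ d.status = .declared2) (by simp [hst]),
          hσ.1.1.weight_type_one hck hk2 hk ht, if_neg (not_le.2 hv)]
        push_cast
        linarith
      · simpa [hck, ind] using ih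
    | neutral c d =>
      simp only [Packing.total_neutral, Packing.count_neutral, Packing.binCount_cons,
        Bin.classNeed, Bin.IsBigTemporary, Bin.IsLight, ind_of_false (p := False) id]
      have hc : (if c.cls = k then c.need P a w k w else 0) ≤
          (if c.cls = k then c.weight P a k u v w else 0) +
          (ind (c.cls = k ∧ c.status.type = 1) * (1 - w - u) +
            ind (c.cls = k ∧ c.status.type = 2) * -Y +
            ind (c.cls = k ∧ c.status = .declared2)) := by
        by_cases hck : c.cls = k
        · have ht := hσ.1.1.type_of_half_lt (hck ▸ hk2) (hck ▸ hk) hσ.1.2.1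
          have w1 := (hσ.1.1.le_weight_type_two (a := a) (w := w) hck hk2 hk ht hu1 huv).1
          rw [if_pos hck, if_pos hck, hneed w c hck,
            ind_of_true (p := c.cls = k ∧ _ = 2) ⟨hck, ht⟩,
            ind_of_false (p := c.cls = k ∧ _ = 1) (by omega)]
          push_cast
          linarith
        · simp [hck, ind]
      have hd : (if d.cls = k then d.need P a w k (1 - w) else 0) ≤
          (if d.cls = k then d.weight P a k u v w else 0) +
          (ind (d.cls = k ∧ d.status.type = 1) * (1 - w - u) +
            ind (d.cls = k ∧ d.status.type = 2) * -Y +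
            ind (d.cls = k ∧ d.status = .declared2)) := by
        by_cases hck : d.cls = k
        · have ht := hσ.1.2.2.1.type_of_le_half (hck ▸ hk2) (hck ▸ hk) hσ.1.2.2.2.1
          rw [if_pos hck, if_pos hck, hneed _ d hck,
            ind_of_true (p := d.cls = k ∧ _ = 1) ⟨hck, ht⟩,
            ind_of_false (p := d.cls = k ∧ _ = 2) (by omega),
            hσ.1.2.2.1.weight_type_one hck hk2 hk ht]
          have h0 : (0 : ℝ) ≤ ind (d.cls = k ∧ d.status = .declared2) := Nat.cast_nonneg _
          split_ifs <;> push_cast <;> linarith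
        · simp [hck, ind]
      push_cast
      linarith

theorem Run.threshold_le (h : Run P I σ) (hI : ∀ s ∈ I, 0 < s ∧ s ≤ 1)
    (hneg : ∀ d, Bin.negative d ∈ σ → 1 - a < d.volume P) (hk2 : 2 ≤ k) (hk : k ≤ P.b)
    (hw0 : 0 ≤ w) (hw1 : w ≤ 1) (hu0 : 0 ≤ u) (hu1 : u ≤ 1) (hv0 : 0 ≤ v) (hv1 : v ≤ 1)
    (huv : u ≤ v) (h1 : 1 ≤ u * (1 + P.α 2 k) + w * P.α 1 k) (h2 : 1 ≤ u * P.α 2 k + v)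
    (h3 : 1 ≤ v * P.α 1 k + 2 * u * P.α 2 k + (1 - w) * P.α 2 k) :
    (σ.map (Bin.classNeed P a w k k)).sum ≤ Packing.classTotal P a k u v w k σ + 12 := by
  refine (sum_classNeed_threshold_le (h.wf hI) hneg hk2 hk hu1 huv rfl).trans ?_
  obtain ⟨a1, a2, a3, -, m₁, m₂, b1, b2, b3, b4, b5⟩ := h.large (β := 1 - a) hk2 hk hI
  have hα₂ := (P.α_large k hk2 hk).le
  have cast1 : ∀ m n : ℕ, m ≤ ⌊P.α 2 k * (n : ℝ)⌋₊ → (m : ℝ) ≤ P.α 2 k * n := fun m n hmn =>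
    (Nat.cast_le.2 hmn).trans (Nat.floor_le (by positivity))
  have cast2 : ∀ m n : ℕ, ⌊P.α 2 k * (n : ℝ)⌋₊ ≤ m + 1 → P.α 2 k * n ≤ (m : ℝ) + 2 := by
    intro m n hmn
    have h1 := (Nat.lt_floor_add_one (P.α 2 k * (n : ℝ))).le
    have h2 : ((⌊P.α 2 k * (n : ℝ)⌋₊ : ℕ) : ℝ) ≤ m + 1 := by exact_mod_cast hmn
    linarith
  have c1 := cast1 _ _ a1
  have c2 := cast2 _ _ a2
  have c3 := cast1 _ _ b1
  have c4 := cast2 _ _ b2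
  push_cast at c1 c2 c3 c4
  have hd : ((Packing.largeStats (1 - a) k σ).declared : ℝ) ≤ 2 := by
    exact_mod_cast (by omega : (Packing.largeStats (1 - a) k σ).declared ≤ 2)
  have := large_class_arithmetic (P.alpha_add hk2 hk) hα₂ hw0 hw1 hu0
    hu1 hv0 hv1 huv h1 h2 h3 c1 c2 hd c3 c4 (by positivity) (Nat.cast_nonneg _)
    (by exact_mod_cast b3) (Nat.cast_le.2 b4) (Nat.cast_le.2 b5)
  linarith

end Threshold

/-- The volume of a container is at least the size of one of its items. -/
theorem Container.WF.exists_item_le_volume {P : Params} {d : Container} (hd : d.WF P) :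
    ∃ s ∈ d.items, s ≤ d.volume P := by
  obtain ⟨s, hs⟩ := exists_mem_of_ne_zero hd.ne_zero
  refine ⟨s, hs, ?_⟩
  by_cases h : d.status.type = 1 ∧ d.cls ≤ P.b
  · rw [volume_of_type_one h.1 h.2]
    exact single_le_sum (fun x hx => (hd.items x hx).1.le) s hs
  · have hs2 := (hd.item_mem_Ioc hs).2
    have hcls := hd.cls_mem
    have h2 : 2 ≤ d.cls := by
      by_contra hc
      have hb := P.two_le_b
      have h1 := (hd.volume_huge (by omega)).1
      exact h ⟨by rw [h1]; rfl, by omega⟩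
    have hi := Finset.mem_Icc.1 (hd.type_mem h2)
    rw [Container.volume, if_neg h, Params.A]
    split_ifs with hM
    · rw [hM, P.gamma_last] at hi
      rw [hM, Nat.add_sub_cancel] at hs2
      exact hs2.trans (P.tinyCap_le hi.1 hi.2)
    · have h1 : (1 : ℝ) ≤ d.status.type := by exact_mod_cast hi.1
      have := P.t_nonneg (j := d.cls - 1) (by omega)
      nlinarith

/-- In the output, no unmatched negative container has volume at most `1 - a`. -/
theorem IsThreshold.lt_volume {P : Params} {I : List ℝ} {σ : Packing} {a : ℝ}
    (h : IsThreshold P I σ a) (hr : Run P I σ) (hI : ∀ s ∈ I, 0 < s ∧ s ≤ 1) {d : Container}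
    (hd : Bin.negative d ∈ σ) : 1 - a < d.volume P := by
  obtain ⟨smin, hmin, ha, -⟩ := h
  rcases ha with ha | ⟨c, hc, ha⟩
  · have hwf := hr.wf hI _ hd
    obtain ⟨s, hs, hsv⟩ := hwf.1.exists_item_le_volume
    have hsI : s ∈ I := by
      have : s ∈ Packing.items σ :=
        mem_bind.2 ⟨d, mem_bind.2 ⟨_, hd, mem_singleton_self d⟩, hs⟩
      rwa [hr.items, mem_coe] at this
    have := hmin.2 hsI
    have := (hI smin hmin.1).1
    linarith
  · have := hr.noFit c d hc hd
    rw [Container.Fits, not_le] at this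
    linarith

end AH
theorem mainTheorem2 (P : AH.Params) :
    ∃ Ψ : ℝ, ∀ (x y : ℝ) (k : ℕ), AH.IsScenario P x y → AH.IsThresholdClass P x y k →
      ∀ u v w : ℝ, 0 ≤ w → w ≤ 1 →
        (1 / 3 < y →
          0 ≤ u ∧ u ≤ 1 ∧ 0 ≤ v ∧ v ≤ 1 ∧ u ≤ v ∧
          1 ≤ u * (1 + P.α 2 k) + w * P.α 1 k ∧
          1 ≤ u * P.α 2 k + v ∧
          1 ≤ v * P.α 1 k + 2 * u * P.α 2 k + (1 - w) * P.α 2 k) →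
        ∀ (I : List ℝ) (σ : AH.Packing) (a : ℝ),
          (∀ s ∈ I, 0 < s ∧ s ≤ 1) → AH.Run P I σ → AH.IsThreshold P I σ a →
          1 - a ∈ Set.Ioc x y →
          (Multiset.card σ : ℝ) ≤ AH.totalWeight P a k u v w I + Ψ := by
  refine ⟨∑ j ∈ Finset.Icc 1 (P.M + 1), (|P.classError j| + 12), ?_⟩
  intro x y k hsc hk u v w hw0 hw1 huv I σ a hI hr ha haxy
  obtain ⟨hk1, hkM, hsub⟩ := hk
  have hat : 1 - a ∈ Set.Ioc (P.t k) (P.t (k - 1)) := hsub haxy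
  have hy := hsub (Set.right_mem_Ioc.2 hsc.2.2.1)
  have hk2 : 2 ≤ k := by
    by_contra hc
    have h1 : k = 1 := by omega
    subst h1
    rw [P.t_one] at hy
    exact absurd hsc.2.1.1 (not_le.2 hy.1)
  have hwf := hr.wf hI
  have hneg : ∀ d, AH.Bin.negative d ∈ σ → 1 - a < d.volume P := fun d => ha.lt_volume hr hI
  have hpos : ∀ c, AH.Bin.positive c ∈ σ → a ≤ c.volume P := by
    obtain ⟨smin, -, -, hlow⟩ := ha
    exact fun c hc => hlow (Or.inr ⟨c, hc, rfl⟩)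
  have hcard := AH.card_le_sum_classNeed (P := P) (a := a) (w := w) (k := k) (σ := σ)
    fun B hB => AH.one_le_sum_classNeed hw0 hw1 (hwf B hB) (fun c h => hpos c (h ▸ hB))
      fun d h => hneg d (h ▸ hB)
  refine hcard.trans ?_
  rw [hr.totalWeight_eq hI, ← Finset.sum_add_distrib]
  refine Finset.sum_le_sum fun j hj => ?_
  rw [Finset.mem_Icc] at hj
  have habs := abs_nonneg (P.classError j)
  by_cases hjk : j = k ∧ k ≤ P.b
  · obtain ⟨rfl, hb⟩ := hjk
    have hbM := P.b_le
    have hty : P.t P.b ≤ P.t j := P.t_le_of_le hb (by omega)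
    rw [P.t_b] at hty
    obtain ⟨hu0, hu1, hv0, hv1, huv, h1, h2, h3⟩ := huv (hty.trans_lt hy.1)
    have := hr.threshold_le hI hneg hk2 hb hw0 hw1 hu0 hu1 hv0 hv1 huv h1 h2 h3
    linarith
  · by_cases hj1 : j = 1
    · subst hj1
      have := hr.huge_le (a := a) (u := u) (v := v) (w := w) hI hjk
      linarith
    · have := hr.basic_le (u := u) (v := v) hI (by omega) hj.2 hjk hk1 hkM hat hw0 hw1
      linarith [le_abs_self (P.classError j)]
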